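/- Let $M$ be a smooth finite-dimensional (Hausdorff) manifold and $L\to M$ a smooth real line bundle. Let $\widetilde M=L^*\smallsetminus 0$ be the dual bundle with its zero section removed, $p:\widetilde M\to M$ the projection, and, for $r\in\mathbb R^\times$, let $h_r:\widetilde M\to\widetilde M$, $h_r(\epsilon)=r\epsilon$. For $\lambda\in\Gamma(L)$ let $\widetilde\lambda\in C^\infty(\widetilde M)$ be $\widetilde\lambda(\epsilon)=\langle\epsilon,\lambda_{p(\epsilon)}\rangle$. Let $J^1L\to M$ be the first jet bundle of $L$, and let $DL\to M$ be the bundle whose fibre at $x$ consists of the linear maps $\Delta:\Gamma(L)\to L_x$ for which there is $v\in T_xM$ with $\Delta(f\lambda)=v(f)\lambda_x+f(x)\Delta\lambda$ for all $f\in C^\infty(M)$, $\lambda\in\Gamma(L)$. For $l,m\ge 0$, an Atiyah $(l,m)$-tensor on $L$ is a smooth section of $(DL)^{*\otimes l}\otimes(J^1L)^{*\otimes m}\otimes L$, i.e. a vector bundle map $(DL)^{\otimes l}\otimes(J^1L)^{\otimes m}\to L$. An $(l,m)$-tensor $\mathcal T$ on $\widetilde M$, i.e. a smooth section of $(T^*\widetilde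 M)^{\otimes l}\otimes(T\widetilde M)^{\otimes m}$, is homogeneous if $h_r^*\mathcal T=r^{1-m}\mathcal T$ for all $r\in\mathbb R^\times$. Theorem. There are isomorphisms of smooth vector bundles over $\widetilde M$ $$p_T:T\widetilde M\to p^*DL,\qquad p_{T^*}:T^*\widetilde M\to p^*J^1L$$ with $\langle\epsilon,p_T(v)\lambda\rangle=v(\widetilde\lambda)$ and $p_{T^*}(d_\epsilon\widetilde\lambda)=j^1_{p(\epsilon)}\lambda$ for all $\epsilon\in\widetilde M$, $v\in T_\epsilon\widetilde M$, $\lambda\in\Gamma(L)$, and for all $l,m\ge 0$ there is an isomorphism of smooth vector bundles over $\widetilde M$ $$\Phi:(T^*\widetilde M)^{\otimes l}\otimes(T\widetilde M)^{\otimes m}\to p^*\big((DL)^{*\otimes l}\otimes(J^1L)^{*\otimes m}\otimes L\big)$$ given by $$\langle\epsilon,\Phi(\mathcal T)(p_Tv_1,\dots,p_Tv_l;p_{T^*}\theta_1,\dots,p_{T^*}\theta_m)\rangle=\mathcal T(v_1,\dots,v_l;\theta_1,\dots,\theta_m)$$ for $\epsilon\in\widetilde M$, $\mathcal T\in(T_\epsilon^*\widetilde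 M)^{\otimes l}\otimes(T_\epsilon\widetilde M)^{\otimes m}$, $v_i\in T_\epsilon\widetilde M$, $\theta_j\in T^*_\epsilon\widetilde M$. Under $\Phi$, a smooth $(l,m)$-tensor $\mathcal T$ on $\widetilde M$ is homogeneous if and only if it corresponds to a pull-back section, i.e. $\Phi\circ\mathcal T=p^*T$ for some Atiyah $(l,m)$-tensor $T$ on $L$. Moreover $T\mapsto\Phi^{-1}\circ p^*T$ is an $\mathbb R$-linear bijection from the Atiyah $(l,m)$-tensors on $L$ onto the homogeneous $(l,m)$-tensors on $\widetilde M$. -/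

import Mathlib

open Bundle Set Filter Topology
open scoped Manifold ContDiff Bundle

universe u v w

set_option linter.unusedSectionVars false

noncomputable section

/-- A smooth real vector bundle over `B`. -/
structure SmoothVB {E H : Type} [NormedAddCommGroup E] [NormedSpace ℝ E] [TopologicalSpace H]
    (I : ModelWithCorners ℝ E H) (B : Type u) [TopologicalSpace B] [ChartedSpace H B] where
  /-- the model fibre -/
  F : Type
  [normF : NormedAddCommGroup F]
  [spaceF : NormedSpace ℝ F]
  /-- the fibres -/
  V : B → Type v
  [addV : ∀ x, AddCommGroup (V x)]
  [modV : ∀ x, Module ℝ (V x)]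
  [topV : ∀ x, TopologicalSpace (V x)]
  [tagV : ∀ x, IsTopologicalAddGroup (V x)]
  [smulV : ∀ x, ContinuousSMul ℝ (V x)]
  [topTotal : TopologicalSpace (TotalSpace F V)]
  [fib : FiberBundle F V]
  [vec : VectorBundle ℝ F V]
  [smooth : ContMDiffVectorBundle ∞ F V I]

attribute [instance] SmoothVB.normF SmoothVB.spaceF SmoothVB.addV SmoothVB.modV SmoothVB.topV
  SmoothVB.tagV SmoothVB.smulV SmoothVB.topTotal SmoothVB.fib SmoothVB.vec SmoothVB.smooth

namespace SmoothVB

section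
variable {E H : Type} [NormedAddCommGroup E] [NormedSpace ℝ E] [TopologicalSpace H]
  {I : ModelWithCorners ℝ E H} {B : Type u} [TopologicalSpace B] [ChartedSpace H B]

/-- Smooth sections. -/
abbrev Sec (A : SmoothVB.{u, v} I B) : Type (max u v) := ContMDiffSection I A.F ∞ A.V

/-- The bundle `Hom(A, C)`. -/
def hom (A C : SmoothVB.{u, v} I B) : SmoothVB I B where
  F := A.F →L[ℝ] C.F
  V := fun x => A.V x →L[ℝ] C.V x

/-- The bundle of maps `A × ⋯ × A → C` (with `k` factors), linear in each argument, in curried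
form: `Hom(A, Hom(A, …, Hom(A, C)))`. -/
def multi (A C : SmoothVB.{u, v} I B) : ℕ → SmoothVB I B
  | 0 => C
  | k + 1 => hom A (multi A C k)

/-- Evaluation of a `k`-linear map on `k` vectors. -/
def eval (A C : SmoothVB.{u, v} I B) {x : B} : (k : ℕ) → (multi A C k).V x → (Fin k → A.V x) → C.V x
  | 0, T, _ => T
  | k + 1, T, v =>
    eval A C k ((show A.V x →L[ℝ] (multi A C k).V x from T) (v 0)) (fun i => v i.succ)

/-- The product line bundle. -/
def trivialLine (I : ModelWithCorners ℝ E H) (B : Type u) [TopologicalSpace B] [ChartedSpace H B] :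
    SmoothVB.{u, 0} I B where
  F := ℝ
  V := Bundle.Trivial B ℝ


/-- The tangent bundle. -/
def tangent (I : ModelWithCorners ℝ E H) (B : Type u) [TopologicalSpace B] [ChartedSpace H B]
    [IsManifold I ∞ B] : SmoothVB.{u, 0} I B where
  F := E
  V := TangentSpace I

/-- The cotangent bundle. -/
def cotangent (I : ModelWithCorners ℝ E H) (B : Type u) [TopologicalSpace B] [ChartedSpace H B]
    [IsManifold I ∞ B] : SmoothVB.{u, 0} I B :=
  hom (tangent I B) (trivialLine I B)

/-- The pull-back of a smooth vector bundle along a smooth map. -/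
def pullback {E' H' : Type} [NormedAddCommGroup E'] [NormedSpace ℝ E'] [TopologicalSpace H']
    {I' : ModelWithCorners ℝ E' H'} {B' : Type w} [TopologicalSpace B'] [ChartedSpace H' B']
    (f : ContMDiffMap I' I B' B ∞) (A : SmoothVB.{u, v} I B) : SmoothVB.{w, v} I' B' where
  F := A.F
  V := f *ᵖ A.V
  addV := fun x => inferInstanceAs (AddCommGroup (A.V (f x)))
  modV := fun x => inferInstanceAs (Module ℝ (A.V (f x)))
  tagV := fun x => inferInstanceAs (IsTopologicalAddGroup (A.V (f x)))
  smulV := fun x => inferInstanceAs (ContinuousSMul ℝ (A.V (f x)))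

/-- The pretrivialization of the family `V'` induced from a trivialization of `A` by
fibrewise linear isomorphisms `V' x ≃ A.V x`. -/
def transportPre (A : SmoothVB.{u, v} I B) (V' : B → Type w) [∀ x, AddCommGroup (V' x)]
    [∀ x, Module ℝ (V' x)] (Φ : ∀ x, V' x ≃ₗ[ℝ] A.V x)
    (e : Trivialization A.F (π A.F A.V)) [e.IsLinear ℝ] : Pretrivialization A.F (π A.F V') where
  toFun p := e ⟨p.1, Φ p.1 p.2⟩
  invFun q := ⟨q.1, (Φ q.1).symm (e.symm q.1 q.2)⟩
  source := π A.F V' ⁻¹' e.baseSet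
  target := e.baseSet ×ˢ univ
  baseSet := e.baseSet
  open_baseSet := e.open_baseSet
  open_target := e.open_baseSet.prod isOpen_univ
  source_eq := rfl
  target_eq := rfl
  map_source' := by
    rintro ⟨x, v⟩ h
    have h' : x ∈ e.baseSet := h
    refine ⟨?_, mem_univ _⟩
    have h1 : (e ⟨x, Φ x v⟩).1 = x := e.coe_fst' h'
    exact h1.symm ▸ h'
  map_target' := fun q h => h.1
  left_inv' := by
    rintro ⟨x, v⟩ h
    have h' : x ∈ e.baseSet := h
    have h1 : (e ⟨x, Φ x v⟩).1 = x := e.coe_fst' h'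
    have h2 : e ⟨x, Φ x v⟩ = (x, (e ⟨x, Φ x v⟩).2) := Prod.ext h1 rfl
    rw [h2]
    simp only
    congr 1
    rw [e.symm_apply_apply_mk h', LinearEquiv.symm_apply_apply]
  right_inv' := by
    rintro ⟨x, w⟩ ⟨h, -⟩
    simp only [LinearEquiv.apply_symm_apply]
    exact e.apply_mk_symm h w
  proj_toFun := fun p h => e.coe_fst' h

lemma transportPre_apply (A : SmoothVB.{u, v} I B) (V' : B → Type w) [∀ x, AddCommGroup (V' x)]
    [∀ x, Module ℝ (V' x)] (Φ : ∀ x, V' x ≃ₗ[ℝ] A.V x)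
    (e : Trivialization A.F (π A.F A.V)) [e.IsLinear ℝ] (p : TotalSpace A.F V') :
    transportPre A V' Φ e p = e ⟨p.1, Φ p.1 p.2⟩ := rfl

lemma transportPre_symm (A : SmoothVB.{u, v} I B) (V' : B → Type w) [∀ x, AddCommGroup (V' x)]
    [∀ x, Module ℝ (V' x)] (Φ : ∀ x, V' x ≃ₗ[ℝ] A.V x)
    (e : Trivialization A.F (π A.F A.V)) [e.IsLinear ℝ] {x : B} (hx : x ∈ e.baseSet) (w : A.F) :
    (transportPre A V' Φ e).symm x w = (Φ x).symm (e.symm x w) := by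
  rw [Pretrivialization.symm_apply _ hx]
  rfl

/-- A family `V'` of vector spaces over `B` with fibrewise linear isomorphisms to the fibres of
the smooth vector bundle `A` is itself a smooth vector bundle. -/
def transport (A : SmoothVB.{u, v} I B) (V' : B → Type w) [∀ x, AddCommGroup (V' x)]
    [∀ x, Module ℝ (V' x)] (Φ : ∀ x, V' x ≃ₗ[ℝ] A.V x) : SmoothVB.{u, w} I B :=
  letI top : ∀ x, TopologicalSpace (V' x) := fun x => .induced (Φ x) inferInstance
  have key : ∀ (e e' : Trivialization A.F (π A.F A.V)) [MemTrivializationAtlas e]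
      [MemTrivializationAtlas e'], ∀ b ∈ e.baseSet ∩ e'.baseSet, ∀ w,
      (e.coordChangeL ℝ e' b : A.F →L[ℝ] A.F) w =
        (transportPre A V' Φ e' ⟨b, (transportPre A V' Φ e).symm b w⟩).2 := by
    intro e e' _ _ b hb w
    rw [transportPre_apply, transportPre_symm _ _ _ _ hb.1]
    simp only [LinearEquiv.apply_symm_apply]
    exact e.coordChangeL_apply e' hb w
  letI P : VectorPrebundle ℝ A.F V' :=
    { pretrivializationAtlas := {t | ∃ (e : Trivialization A.F (π A.F A.V))
        (_ : MemTrivializationAtlas e), t = transportPre A V' Φ e}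
      pretrivialization_linear' := by
        rintro _ ⟨e, he, rfl⟩
        refine ⟨fun x hx => ?_⟩
        have h := Trivialization.linear ℝ e hx
        constructor
        · intro v w
          simp only [transportPre_apply, map_add]
          exact h.map_add _ _
        · intro c v
          simp only [transportPre_apply, map_smul]
          exact h.map_smul _ _
      pretrivializationAt := fun x => transportPre A V' Φ (trivializationAt A.F A.V x)
      mem_base_pretrivializationAt := fun x => FiberBundle.mem_baseSet_trivializationAt' x
      pretrivialization_mem_atlas := fun x => ⟨_, inferInstance, rfl⟩
      exists_coordChange := by
        rintro _ ⟨e, he, rfl⟩ _ ⟨e', he', rfl⟩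
        exact ⟨_, continuousOn_coordChange ℝ e e', key e e'⟩
      totalSpaceMk_isInducing := fun x => by
        let L : A.V x ≃L[ℝ] A.F := (trivializationAt A.F A.V x).continuousLinearEquivAt ℝ x
          (FiberBundle.mem_baseSet_trivializationAt' x)
        have h : IsInducing fun w : V' x => (x, L (Φ x w)) :=
          isInducing_const_prod.mpr (L.toHomeomorph.isInducing.comp ⟨rfl⟩)
        convert h using 1
        ext w
        · exact (trivializationAt A.F A.V x).coe_fst'
            (FiberBundle.mem_baseSet_trivializationAt' x)
        · rfl }
  haveI : P.IsContMDiff I ∞ := ⟨by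
    rintro _ ⟨e, he, rfl⟩ _ ⟨e', he', rfl⟩
    exact ⟨_, contMDiffOn_coordChangeL e e', key e e'⟩⟩
  letI := P.totalSpaceTopology
  letI := P.toFiberBundle
  haveI := P.toVectorBundle
  haveI := P.contMDiffVectorBundle (n := ∞) I
  { F := A.F
    V := V'
    tagV := fun x => topologicalAddGroup_induced (Φ x)
    smulV := fun x => continuousSMul_induced (Φ x).toLinearMap }

/-- An isomorphism of smooth vector bundles over the identity. -/
structure Iso (A : SmoothVB.{u, v} I B) (C : SmoothVB.{u, w} I B) where
  toFun : ∀ x, A.V x ≃L[ℝ] C.V x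
  smooth_toFun : ContMDiff (I.prod 𝓘(ℝ, A.F)) (I.prod 𝓘(ℝ, C.F)) ∞
    (fun p : TotalSpace A.F A.V => (⟨p.1, toFun p.1 p.2⟩ : TotalSpace C.F C.V))
  smooth_invFun : ContMDiff (I.prod 𝓘(ℝ, C.F)) (I.prod 𝓘(ℝ, A.F)) ∞
    (fun p : TotalSpace C.F C.V => (⟨p.1, (toFun p.1).symm p.2⟩ : TotalSpace A.F A.V))

end

/-- The fibres of a vector bundle are topological vector spaces. -/
lemma fibre_isTopologicalAddGroup {B : Type u} {F : Type} [TopologicalSpace B]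
    [NormedAddCommGroup F] [NormedSpace ℝ F] (V : B → Type v)
    [∀ x, AddCommGroup (V x)] [∀ x, Module ℝ (V x)] [∀ x, TopologicalSpace (V x)]
    [TopologicalSpace (TotalSpace F V)] [FiberBundle F V] [VectorBundle ℝ F V] (x : B) :
    IsTopologicalAddGroup (V x) := by
  let e := (trivializationAt F V x).continuousLinearEquivAt ℝ x
    (FiberBundle.mem_baseSet_trivializationAt' x)
  rw [e.toHomeomorph.isInducing.eq_induced]
  exact topologicalAddGroup_induced e.toLinearEquiv

/-- The fibres of a vector bundle are topological vector spaces. -/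
lemma fibre_continuousSMul {B : Type u} {F : Type} [TopologicalSpace B]
    [NormedAddCommGroup F] [NormedSpace ℝ F] (V : B → Type v)
    [∀ x, AddCommGroup (V x)] [∀ x, Module ℝ (V x)] [∀ x, TopologicalSpace (V x)]
    [TopologicalSpace (TotalSpace F V)] [FiberBundle F V] [VectorBundle ℝ F V] (x : B) :
    ContinuousSMul ℝ (V x) := by
  let e := (trivializationAt F V x).continuousLinearEquivAt ℝ x
    (FiberBundle.mem_baseSet_trivializationAt' x)
  rw [e.toHomeomorph.isInducing.eq_induced]
  exact continuousSMul_induced e.toLinearEquiv.toLinearMap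

/-- Linear maps on the fibres of a vector bundle of finite rank are continuous. -/
lemma continuous_of_fibre {E H : Type} [NormedAddCommGroup E] [NormedSpace ℝ E]
    [TopologicalSpace H] {I : ModelWithCorners ℝ E H} {B : Type u} [TopologicalSpace B]
    [ChartedSpace H B] (A : SmoothVB.{u, v} I B) [FiniteDimensional ℝ A.F] {x : B} {W : Type w}
    [AddCommGroup W] [Module ℝ W] [TopologicalSpace W] [IsTopologicalAddGroup W]
    [ContinuousSMul ℝ W] (f : A.V x →ₗ[ℝ] W) : Continuous f := by
  let e := (trivializationAt A.F A.V x).continuousLinearEquivAt ℝ x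
    (FiberBundle.mem_baseSet_trivializationAt' x)
  have h : Continuous (f ∘ₗ e.symm.toLinearEquiv.toLinearMap) :=
    LinearMap.continuous_of_finiteDimensional _
  have h2 := h.comp e.continuous
  refine h2.congr fun w => ?_
  simp

end SmoothVB

namespace LineBundle

section
variable (E : Type) [NormedAddCommGroup E] [NormedSpace ℝ E]
  {M : Type u} [TopologicalSpace M] [ChartedSpace E M]
  (L : M → Type u) [TopologicalSpace (TotalSpace ℝ L)] [∀ x, AddCommGroup (L x)]
  [∀ x, Module ℝ (L x)] [∀ x, TopologicalSpace (L x)] [FiberBundle ℝ L] [VectorBundle ℝ ℝ L]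

/-- The smooth sections of the line bundle `L`. -/
abbrev Sec : Type u := ContMDiffSection 𝓘(ℝ, E) ℝ ∞ L

variable {E L}

/-- The section `s` read in the preferred local trivialization of `L` around `i`. -/
def loc (i : M) (s : Sec E L) (y : M) : ℝ := (trivializationAt ℝ L i ⟨y, s y⟩).2

variable (E L) in
/-- The common domain of the preferred chart of `M` and the preferred trivialization of `L`
around `i`. -/
def base (i : M) : Set M := (chartAt E i).source ∩ (trivializationAt ℝ L i).baseSet

lemma isOpen_base (i : M) : IsOpen (base E L i) :=
  (chartAt E i).open_source.inter (trivializationAt ℝ L i).open_baseSet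

lemma mem_base (i : M) : i ∈ base E L i :=
  ⟨mem_chart_source E i, FiberBundle.mem_baseSet_trivializationAt' i⟩

lemma loc_add {i y : M} (h : y ∈ base E L i) (s t : Sec E L) :
    loc i (s + t) y = loc i s y + loc i t y :=
  ((trivializationAt ℝ L i).linear ℝ h.2).map_add _ _

lemma loc_smul {i y : M} (h : y ∈ base E L i) (c : ℝ) (s : Sec E L) :
    loc i (c • s) y = c * loc i s y :=
  ((trivializationAt ℝ L i).linear ℝ h.2).map_smul _ _

variable [ContMDiffVectorBundle ∞ ℝ L 𝓘(ℝ, E)]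

lemma contMDiffOn_loc (i : M) (s : Sec E L) :
    ContMDiffOn 𝓘(ℝ, E) 𝓘(ℝ, ℝ) ∞ (loc i s) (base E L i) :=
  (((trivializationAt ℝ L i).contMDiffOn_section_baseSet_iff).1 s.contMDiff.contMDiffOn).mono
    inter_subset_right

lemma mdifferentiableAt_loc {i y : M} (h : y ∈ base E L i) (s : Sec E L) :
    MDifferentiableAt 𝓘(ℝ, E) 𝓘(ℝ, ℝ) (loc i s) y :=
  ((contMDiffOn_loc i s).contMDiffAt ((isOpen_base i).mem_nhds h)).mdifferentiableAt (by simp)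

/-- The section `f s`, for a smooth function `f` and a section `s`. -/
def fsmul (f : C^∞⟮𝓘(ℝ, E), M; ℝ⟯) (s : Sec E L) : Sec E L :=
  ⟨fun y => f y • s y, f.contMDiff.smul_section s.contMDiff⟩

lemma loc_fsmul {i y : M} (h : y ∈ base E L i) (f : C^∞⟮𝓘(ℝ, E), M; ℝ⟯) (s : Sec E L) :
    loc i (fsmul f s) y = f y * loc i s y :=
  ((trivializationAt ℝ L i).linear ℝ h.2).map_smul _ _

variable (E L) in
/-- The sections of `L` vanishing to first order at `x`: both the section and its first
derivative (read in a local trivialization) vanish at `x`. -/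
def vanishing (x : M) : Submodule ℝ (Sec E L) where
  carrier := {s | s x = 0 ∧ mfderiv 𝓘(ℝ, E) 𝓘(ℝ, ℝ) (loc x s) x = 0}
  zero_mem' := by
    refine ⟨rfl, ?_⟩
    have : loc x (0 : Sec E L) =ᶠ[𝓝 x] fun _ => 0 := by
      filter_upwards [(isOpen_base (E := E) (L := L) x).mem_nhds (mem_base x)] with y hy
      simpa using loc_smul hy 0 0
    rw [this.mfderiv_eq]
    exact mfderiv_const
  add_mem' := by
    rintro s t ⟨hs, hs'⟩ ⟨ht, ht'⟩
    refine ⟨by simp [hs, ht], ?_⟩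
    have : loc x (s + t) =ᶠ[𝓝 x] loc x s + loc x t := by
      filter_upwards [(isOpen_base (E := E) (L := L) x).mem_nhds (mem_base x)] with y hy
      exact loc_add hy s t
    rw [this.mfderiv_eq]
    refine (mfderiv_add (mdifferentiableAt_loc (mem_base x) s)
      (mdifferentiableAt_loc (mem_base x) t)).trans ?_
    rw [hs', ht']
    exact add_zero _
  smul_mem' := by
    rintro c s ⟨hs, hs'⟩
    refine ⟨by simp [hs], ?_⟩
    have : loc x (c • s) =ᶠ[𝓝 x] c • loc x s := by
      filter_upwards [(isOpen_base (E := E) (L := L) x).mem_nhds (mem_base x)] with y hy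
      exact loc_smul hy c s
    rw [this.mfderiv_eq]
    refine (const_smul_mfderiv (mdifferentiableAt_loc (mem_base x) s) c).trans ?_
    rw [hs']
    exact smul_zero c

variable (E L) in
/-- The space of `1`-jets at `x` of sections of `L`. -/
def Jet (x : M) : Type u := Sec E L ⧸ vanishing E L x

instance (x : M) : AddCommGroup (Jet E L x) :=
  inferInstanceAs (AddCommGroup (Sec E L ⧸ vanishing E L x))

instance (x : M) : Module ℝ (Jet E L x) :=
  inferInstanceAs (Module ℝ (Sec E L ⧸ vanishing E L x))

/-- The `1`-jet of a section at the point `x`. -/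
def jet (x : M) : Sec E L →ₗ[ℝ] Jet E L x := (vanishing E L x).mkQ

/-- `Δ` satisfies the Leibniz rule at the point `x`, with symbol `v`. -/
def HasSymbol {x : M} (Δ : Sec E L →ₗ[ℝ] L x) (v : TangentSpace 𝓘(ℝ, E) x) : Prop :=
  ∀ (f : C^∞⟮𝓘(ℝ, E), M; ℝ⟯) (s : Sec E L),
    Δ (fsmul f s) = (show ℝ from mfderiv 𝓘(ℝ, E) 𝓘(ℝ, ℝ) f x v) • s x + f x • Δ s

variable (E L) in
/-- The space of derivations of `L` at `x`: linear maps `Γ(L) → L_x` satisfying the Leibniz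
rule for some tangent vector at `x`. -/
def Der (x : M) : Submodule ℝ (Sec E L →ₗ[ℝ] L x) where
  carrier := {Δ | ∃ v, HasSymbol Δ v}
  zero_mem' := ⟨0, fun f s => by
    rw [(mfderiv 𝓘(ℝ, E) 𝓘(ℝ, ℝ) f x).map_zero]
    exact (by simp : (0 : L x) = (0 : ℝ) • s x + f x • 0)⟩
  add_mem' := by
    rintro Δ Δ' ⟨v, hv⟩ ⟨v', hv'⟩
    refine ⟨v + v', fun f s => ?_⟩
    rw [(mfderiv 𝓘(ℝ, E) 𝓘(ℝ, ℝ) f x).map_add]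
    refine (congrArg₂ (· + ·) (hv f s) (hv' f s)).trans ?_
    simp only [LinearMap.add_apply, smul_add]
    refine Eq.trans ?_ (congrArg (· + _) (add_smul _ _ _).symm)
    abel
  smul_mem' := by
    rintro c Δ ⟨v, hv⟩
    refine ⟨c • v, fun f s => ?_⟩
    rw [(mfderiv 𝓘(ℝ, E) 𝓘(ℝ, ℝ) f x).map_smul]
    refine (congrArg (c • ·) (hv f s)).trans ?_
    simp only [LinearMap.smul_apply, smul_add]
    rw [smul_comm (f x) c]
    refine congrArg (· + _) ?_
    exact (mul_smul _ _ _).symm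


variable (E L) in
/-- The transition function between the preferred local trivializations of `L` around `i`
and `j`. -/
def trans (i j x : M) : ℝ :=
  (trivializationAt ℝ L i).coordChangeL ℝ (trivializationAt ℝ L j) x 1

lemma contMDiffOn_trans (i j : M) :
    ContMDiffOn 𝓘(ℝ, E) 𝓘(ℝ, ℝ) ∞ (trans L i j) (base E L i ∩ base E L j) := by
  have h := contMDiffOn_coordChangeL (IB := 𝓘(ℝ, E)) (n := ∞) (trivializationAt ℝ L i)
    (trivializationAt ℝ L j)
  exact (h.clm_apply contMDiffOn_const).mono fun x hx => ⟨hx.1.2, hx.2.2⟩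

lemma loc_trans {i j y : M} (hi : y ∈ base E L i) (hj : y ∈ base E L j) (s : Sec E L) :
    loc j s y = trans L i j y * loc i s y := by
  have h := (trivializationAt ℝ L i).coordChangeL_apply (R := ℝ) (trivializationAt ℝ L j)
    ⟨hi.2, hj.2⟩ (loc i s y)
  have h2 : (trivializationAt ℝ L i).symm y (loc i s y) = s y :=
    (trivializationAt ℝ L i).symm_apply_apply_mk hi.2 (s y)
  rw [h2] at h
  rw [loc, ← h, trans, mul_comm, ← smul_eq_mul, ← map_smul, smul_eq_mul, mul_one]

/-- The value of a derivation `Δ` at `x` on a section `s`. -/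
def derApply {x : M} (Δ : Der E L x) (s : Sec E L) : L x := Δ.1 s

variable [IsManifold 𝓘(ℝ, E) ∞ M]

/-- The derivative at `φ i x` of `h` read in the chart `φ i` depends smoothly on `x`. -/
lemma contMDiffOn_fderiv {G : Type} [NormedAddCommGroup G] [NormedSpace ℝ G] {h : M → G} {i : M}
    {U : Set M} (hU : IsOpen U) (hUi : U ⊆ (chartAt E i).source)
    (hh : ContMDiffOn 𝓘(ℝ, E) 𝓘(ℝ, G) ∞ h U) :
    ContMDiffOn 𝓘(ℝ, E) 𝓘(ℝ, E →L[ℝ] G) ∞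
      (fun x => fderiv ℝ (h ∘ (chartAt E i).symm) (chartAt E i x)) U := by
  have hV : IsOpen ((chartAt E i).target ∩ (chartAt E i).symm ⁻¹' U) :=
    (chartAt E i).isOpen_inter_preimage_symm hU
  have h1 : ContMDiffOn 𝓘(ℝ, E) 𝓘(ℝ, G) ∞ (h ∘ (chartAt E i).symm)
      ((chartAt E i).target ∩ (chartAt E i).symm ⁻¹' U) :=
    hh.comp ((contMDiffOn_chart_symm (I := 𝓘(ℝ, E)) (x := i)).mono inter_subset_left)
      fun y hy => hy.2
  have h2 := (h1.contDiffOn.fderiv_of_isOpen hV (m := ∞) (by simp)).contMDiffOn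
  refine h2.comp ((contMDiffOn_chart (I := 𝓘(ℝ, E)) (x := i)).mono hUi) fun y hy => ?_
  refine ⟨(chartAt E i).map_source (hUi hy), ?_⟩
  simpa [(chartAt E i).left_inv (hUi hy)] using hy

lemma differentiableAt_comp_symm {G : Type} [NormedAddCommGroup G] [NormedSpace ℝ G] {h : M → G}
    {i x : M} {U : Set M} (hU : IsOpen U) (hxi : x ∈ (chartAt E i).source) (hx : x ∈ U)
    (hh : ContMDiffOn 𝓘(ℝ, E) 𝓘(ℝ, G) ∞ h U) :
    DifferentiableAt ℝ (h ∘ (chartAt E i).symm) (chartAt E i x) := by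
  have h1 : ContMDiffAt 𝓘(ℝ, E) 𝓘(ℝ, G) ∞ h ((chartAt E i).symm (chartAt E i x)) := by
    rw [(chartAt E i).left_inv hxi]
    exact hh.contMDiffAt (hU.mem_nhds hx)
  have h2 : ContMDiffAt 𝓘(ℝ, E) 𝓘(ℝ, E) ∞ (chartAt E i).symm (chartAt E i x) :=
    (contMDiffOn_chart_symm (I := 𝓘(ℝ, E)) (x := i)).contMDiffAt
      ((chartAt E i).open_target.mem_nhds ((chartAt E i).map_source hxi))
  exact (h1.comp _ h2).contDiffAt.differentiableAt (by simp)

/-- The `1`-jet at `x` of a section in the local coordinates around `i`: value and derivative. -/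
def jetC (i x : M) (s : Sec E L) : ℝ × (E →L[ℝ] ℝ) :=
  (loc i s x, fderiv ℝ (loc i s ∘ (chartAt E i).symm) (chartAt E i x))

lemma eventually_symm {i x : M} (hxi : x ∈ (chartAt E i).source) {p : M → Prop}
    (hp : ∀ᶠ y in 𝓝 x, p y) : ∀ᶠ z in 𝓝 (chartAt E i x), p ((chartAt E i).symm z) := by
  have h := (chartAt E i).continuousAt_symm ((chartAt E i).map_source hxi)
  rw [ContinuousAt, (chartAt E i).left_inv hxi] at h
  exact h.eventually hp

lemma jetC_add {i x : M} (hx : x ∈ base E L i) (s t : Sec E L) :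
    jetC i x (s + t) = jetC i x s + jetC i x t := by
  refine Prod.ext (loc_add hx s t) ?_
  have h1 : loc i (s + t) ∘ (chartAt E i).symm =ᶠ[𝓝 (chartAt E i x)]
      (loc i s ∘ (chartAt E i).symm) + (loc i t ∘ (chartAt E i).symm) :=
    eventually_symm hx.1 (p := fun y => loc i (s + t) y = loc i s y + loc i t y) <| by
      filter_upwards [(isOpen_base i).mem_nhds hx] with y hy using loc_add hy s t
  refine h1.fderiv_eq.trans ?_
  exact fderiv_add (differentiableAt_comp_symm (isOpen_base i) hx.1 hx (contMDiffOn_loc i s))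
    (differentiableAt_comp_symm (isOpen_base i) hx.1 hx (contMDiffOn_loc i t))

lemma jetC_smul {i x : M} (hx : x ∈ base E L i) (c : ℝ) (s : Sec E L) :
    jetC i x (c • s) = c • jetC i x s := by
  refine Prod.ext (loc_smul hx c s) ?_
  have h1 : loc i (c • s) ∘ (chartAt E i).symm =ᶠ[𝓝 (chartAt E i x)]
      c • (loc i s ∘ (chartAt E i).symm) :=
    eventually_symm hx.1 (p := fun y => loc i (c • s) y = c * loc i s y) <| by
      filter_upwards [(isOpen_base i).mem_nhds hx] with y hy using loc_smul hy c s
  refine h1.fderiv_eq.trans ?_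
  exact fderiv_const_smul
    (differentiableAt_comp_symm (isOpen_base i) hx.1 hx (contMDiffOn_loc i s)) c

/-- `jetC` as a linear map. -/
def jetL {i x : M} (hx : x ∈ base E L i) : Sec E L →ₗ[ℝ] ℝ × (E →L[ℝ] ℝ) where
  toFun := jetC i x
  map_add' := jetC_add hx
  map_smul' := jetC_smul hx

lemma jetC_fsmul {i x : M} (hx : x ∈ base E L i) (f : C^∞⟮𝓘(ℝ, E), M; ℝ⟯) (s : Sec E L) :
    jetC i x (fsmul f s) = f x • jetC i x s +
      (0, loc i s x • fderiv ℝ (f ∘ (chartAt E i).symm) (chartAt E i x)) := by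
  refine Prod.ext ((loc_fsmul hx f s).trans (by simp [jetC])) ?_
  have h1 : loc i (fsmul f s) ∘ (chartAt E i).symm =ᶠ[𝓝 (chartAt E i x)]
      (f ∘ (chartAt E i).symm) * (loc i s ∘ (chartAt E i).symm) :=
    eventually_symm hx.1 (p := fun y => loc i (fsmul f s) y = f y * loc i s y) <| by
      filter_upwards [(isOpen_base i).mem_nhds hx] with y hy using loc_fsmul hy f s
  refine h1.fderiv_eq.trans ?_
  refine (fderiv_mul (differentiableAt_comp_symm isOpen_univ hx.1 (mem_univ _)
    f.contMDiff.contMDiffOn)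
    (differentiableAt_comp_symm (isOpen_base i) hx.1 hx (contMDiffOn_loc i s))).trans ?_
  simp [jetC, (chartAt E i).left_inv hx.1]

variable (E L) in
/-- The change of local coordinates on `1`-jets. -/
def jetChange (i j x : M) : (ℝ × (E →L[ℝ] ℝ)) →L[ℝ] (ℝ × (E →L[ℝ] ℝ)) :=
  trans L i j x • (ContinuousLinearMap.inl ℝ ℝ (E →L[ℝ] ℝ)).comp
      (ContinuousLinearMap.fst ℝ ℝ (E →L[ℝ] ℝ)) +
  (ContinuousLinearMap.inr ℝ ℝ (E →L[ℝ] ℝ)).comp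
    ((ContinuousLinearMap.smulRightL ℝ _ _ (ContinuousLinearMap.fst ℝ ℝ (E →L[ℝ] ℝ)))
      (fderiv ℝ (trans L i j ∘ (chartAt E j).symm) (chartAt E j x))) +
  trans L i j x • (ContinuousLinearMap.inr ℝ ℝ (E →L[ℝ] ℝ)).comp
    (((ContinuousLinearMap.compL ℝ E E ℝ).flip
      (fderiv ℝ (chartAt E i ∘ (chartAt E j).symm) (chartAt E j x))).comp
        (ContinuousLinearMap.snd ℝ ℝ (E →L[ℝ] ℝ)))

lemma jetChange_apply (i j x : M) (b : ℝ) (α : E →L[ℝ] ℝ) :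
    jetChange E L i j x (b, α) = (trans L i j x * b,
      b • fderiv ℝ (trans L i j ∘ (chartAt E j).symm) (chartAt E j x) +
      trans L i j x • α.comp (fderiv ℝ (chartAt E i ∘ (chartAt E j).symm) (chartAt E j x))) := by
  simp [jetChange]

lemma contMDiffOn_jetChange (i j : M) :
    ContMDiffOn 𝓘(ℝ, E) 𝓘(ℝ, (ℝ × (E →L[ℝ] ℝ)) →L[ℝ] (ℝ × (E →L[ℝ] ℝ))) ∞ (jetChange E L i j)
      (base E L i ∩ base E L j) := by
  have hU := (isOpen_base (E := E) (L := L) i).inter (isOpen_base (E := E) (L := L) j)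
  have h1 := contMDiffOn_trans (E := E) (L := L) i j
  have h2 := contMDiffOn_fderiv hU (fun x hx => hx.2.1) h1
  have h3 : ContMDiffOn 𝓘(ℝ, E) 𝓘(ℝ, E →L[ℝ] E) ∞
      (fun x => fderiv ℝ (chartAt E i ∘ (chartAt E j).symm) (chartAt E j x))
      (base E L i ∩ base E L j) := contMDiffOn_fderiv hU (fun x hx => hx.2.1)
    ((contMDiffOn_chart (I := 𝓘(ℝ, E)) (x := i)).mono fun x hx => hx.1.1)
  refine ((h1.smul contMDiffOn_const).add (contMDiffOn_const.clm_comp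
    (contMDiffOn_const.clm_apply h2))).add (h1.smul (contMDiffOn_const.clm_comp
    ((contMDiffOn_const.clm_apply h3).clm_comp contMDiffOn_const)))

lemma jetChange_jetC {i j x : M} (hi : x ∈ base E L i) (hj : x ∈ base E L j) (s : Sec E L) :
    jetChange E L i j x (jetC i x s) = jetC j x s := by
  have hU := (isOpen_base (E := E) (L := L) i).inter (isOpen_base (E := E) (L := L) j)
  rw [jetC, jetChange_apply]
  refine Prod.ext (loc_trans hi hj s).symm (Eq.symm ?_)
  have h1 : loc j s ∘ (chartAt E j).symm =ᶠ[𝓝 (chartAt E j x)]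
      (trans L i j ∘ (chartAt E j).symm) *
        ((loc i s ∘ (chartAt E i).symm) ∘ (chartAt E i ∘ (chartAt E j).symm)) :=
    eventually_symm hj.1 (p := fun y => loc j s y = trans L i j y *
      loc i s ((chartAt E i).symm (chartAt E i y))) <| by
      filter_upwards [hU.mem_nhds ⟨hi, hj⟩] with y hy
      rw [(chartAt E i).left_inv hy.1.1]
      exact loc_trans hy.1 hy.2 s
  have d1 := differentiableAt_comp_symm hU hj.1 ⟨hi, hj⟩ (contMDiffOn_trans (E := E) (L := L) i j)
  have d2 : DifferentiableAt ℝ (chartAt E i ∘ (chartAt E j).symm) (chartAt E j x) :=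
    differentiableAt_comp_symm (chartAt E i).open_source hj.1 hi.1
      (contMDiffOn_chart (I := 𝓘(ℝ, E)) (x := i))
  have e : (chartAt E i ∘ (chartAt E j).symm) (chartAt E j x) = chartAt E i x := by
    simp [(chartAt E j).left_inv hj.1]
  have d3 : DifferentiableAt ℝ (loc i s ∘ (chartAt E i).symm)
      ((chartAt E i ∘ (chartAt E j).symm) (chartAt E j x)) := by
    rw [e]
    exact differentiableAt_comp_symm (isOpen_base i) hi.1 hi (contMDiffOn_loc i s)
  refine h1.fderiv_eq.trans ((fderiv_mul d1 (d3.comp _ d2)).trans ?_)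
  rw [fderiv_comp _ d3 d2, e]
  simp only [Function.comp_apply, (chartAt E j).left_inv hj.1, (chartAt E i).left_inv hi.1]
  exact add_comm _ _


lemma mfderiv_eq_fderiv {G : Type} [NormedAddCommGroup G] [NormedSpace ℝ G] {h : M → G} {x : M}
    (hh : MDifferentiableAt 𝓘(ℝ, E) 𝓘(ℝ, G) h x) :
    mfderiv 𝓘(ℝ, E) 𝓘(ℝ, G) h x = fderiv ℝ (h ∘ (chartAt E x).symm) (chartAt E x x) := by
  refine hh.mfderiv.trans ?_
  simp only [writtenInExtChartAt, extChartAt, OpenPartialHomeomorph.extend, modelWithCornersSelf_partialEquiv,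
    PartialEquiv.trans_refl, modelWithCornersSelf_coe, range_id, fderivWithin_univ]
  rfl

lemma mem_vanishing_iff {x : M} (s : Sec E L) : s ∈ vanishing E L x ↔ jetC x x s = 0 := by
  have h0 : s x = 0 ↔ loc x s x = 0 := by
    have h := (trivializationAt ℝ L x).continuousLinearEquivAt ℝ x (mem_base (E := E) x).2
    exact (((trivializationAt ℝ L x).continuousLinearEquivAt ℝ x
      (mem_base (E := E) x).2).map_eq_zero_iff (x := s x)).symm
  change (s x = 0 ∧ mfderiv 𝓘(ℝ, E) 𝓘(ℝ, ℝ) (loc x s) x = 0) ↔ _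
  rw [h0, jetC, Prod.mk_eq_zero, mfderiv_eq_fderiv (mdifferentiableAt_loc (mem_base x) s)]
  exact Iff.rfl

variable [FiniteDimensional ℝ E] [T2Space M]

lemma exists_bump {x : M} {U : Set M} (hU : IsOpen U) (hx : x ∈ U) :
    ∃ χ : C^∞⟮𝓘(ℝ, E), M; ℝ⟯, (∀ᶠ y in 𝓝 x, χ y = 1) ∧ tsupport χ ⊆ U := by
  obtain ⟨f, -, hf⟩ := (SmoothBumpFunction.nhds_basis_tsupport (I := 𝓘(ℝ, E)) x).mem_iff.1
    (hU.mem_nhds hx)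
  exact ⟨⟨f, f.contMDiff⟩, f.eventuallyEq_one, hf⟩

/-- The section `χ · h · e`, where `e` is the preferred local frame of `L` around `i` and `χ` is
a cut-off function. -/
def cutSec (i : M) (χ : C^∞⟮𝓘(ℝ, E), M; ℝ⟯) (hχ : tsupport χ ⊆ base E L i) (h : M → ℝ)
    (hh : ContMDiffOn 𝓘(ℝ, E) 𝓘(ℝ, ℝ) ∞ h (base E L i)) : Sec E L :=
  ⟨fun y => χ y • (trivializationAt ℝ L i).symm y (h y), by
    refine ContMDiffOn.smul_section_of_tsupport (u := base E L i) χ.contMDiff.contMDiffOn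
      (isOpen_base i) hχ ?_
    refine ((trivializationAt ℝ L i).contMDiffOn_section_iff
      (IB := 𝓘(ℝ, E)) (isOpen_base i) inter_subset_right).2 ?_
    refine hh.congr fun y hy => ?_
    rw [(trivializationAt ℝ L i).apply_mk_symm hy.2]⟩

lemma loc_cutSec {i y : M} (hy : y ∈ base E L i) (χ : C^∞⟮𝓘(ℝ, E), M; ℝ⟯)
    (hχ : tsupport χ ⊆ base E L i) (h : M → ℝ)
    (hh : ContMDiffOn 𝓘(ℝ, E) 𝓘(ℝ, ℝ) ∞ h (base E L i)) :
    loc i (cutSec i χ hχ h hh) y = χ y * h y := by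
  refine (((trivializationAt ℝ L i).linear ℝ hy.2).map_smul _ _).trans ?_
  rw [(trivializationAt ℝ L i).apply_mk_symm hy.2]
  rfl

lemma jetC_surjective {i x : M} (hx : x ∈ base E L i) :
    Function.Surjective (jetC (L := L) (E := E) i x) := by
  rintro ⟨b, α⟩
  obtain ⟨χ, h1, hχ⟩ := exists_bump (E := E) (isOpen_base (E := E) (L := L) i) hx
  have hh : ContMDiffOn 𝓘(ℝ, E) 𝓘(ℝ, ℝ) ∞ (fun y => b + α (chartAt E i y - chartAt E i x))
      (base E L i) := by
    refine contMDiffOn_const.add (contMDiffOn_const.clm_apply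
      (ContMDiffOn.sub ?_ contMDiffOn_const))
    exact (contMDiffOn_chart (I := 𝓘(ℝ, E)) (x := i)).mono inter_subset_left
  refine ⟨cutSec i χ hχ _ hh, Prod.ext ?_ ?_⟩
  · simp [jetC, loc_cutSec hx, h1.self_of_nhds]
  · have e : loc i (cutSec i χ hχ _ hh) ∘ (chartAt E i).symm =ᶠ[𝓝 (chartAt E i x)]
        fun z => b + α (z - chartAt E i x) := by
      have := eventually_symm hx.1 (p := fun y => loc i (cutSec i χ hχ _ hh) y =
          b + α (chartAt E i y - chartAt E i x)) <| by
        filter_upwards [(isOpen_base (E := E) (L := L) i).mem_nhds hx, h1] with y hy hy1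
        rw [loc_cutSec hy, hy1, one_mul]
      filter_upwards [this, (chartAt E i).open_target.mem_nhds
        ((chartAt E i).map_source hx.1)] with z hz hz'
      rw [Function.comp_apply, hz, (chartAt E i).right_inv hz']
    refine e.fderiv_eq.trans ?_
    rw [fderiv_const_add]
    have : HasFDerivAt (fun z => α (z - chartAt E i x)) (α.comp (.id ℝ E)) (chartAt E i x) :=
      α.hasFDerivAt.comp _ ((hasFDerivAt_id _).sub_const _)
    simpa using this.fderiv

variable (E L) in
/-- The vector bundle with fibre `ℝ × E*` and the transition functions of `1`-jets. -/
def jetCore : VectorBundleCore ℝ M (ℝ × (E →L[ℝ] ℝ)) M where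
  baseSet := base E L
  isOpen_baseSet := isOpen_base
  indexAt := id
  mem_baseSet_at := mem_base
  coordChange := jetChange E L
  coordChange_self i x hx v := by
    obtain ⟨s, rfl⟩ := jetC_surjective hx v
    exact jetChange_jetC hx hx s
  continuousOn_coordChange i j := (contMDiffOn_jetChange i j).continuousOn
  coordChange_comp i j k x hx v := by
    obtain ⟨s, rfl⟩ := jetC_surjective hx.1.1 v
    rw [jetChange_jetC hx.1.1 hx.1.2, jetChange_jetC hx.1.2 hx.2, jetChange_jetC hx.1.1 hx.2]

instance : (jetCore E L).IsContMDiff 𝓘(ℝ, E) ∞ := ⟨contMDiffOn_jetChange⟩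

variable (E L) in
/-- The bundle with core `jetCore`. -/
def jetModel : SmoothVB.{u, 0} 𝓘(ℝ, E) M where
  F := ℝ × (E →L[ℝ] ℝ)
  V := (jetCore E L).Fiber
  tagV := fun _ => inferInstanceAs (IsTopologicalAddGroup (ℝ × (E →L[ℝ] ℝ)))
  smulV := fun _ => inferInstanceAs (ContinuousSMul ℝ (ℝ × (E →L[ℝ] ℝ)))

lemma vanishing_eq_ker (x : M) :
    vanishing E L x = LinearMap.ker (jetL (L := L) (mem_base (E := E) x)) := by
  ext s
  exact mem_vanishing_iff s

variable (E L) in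
/-- A `1`-jet at `x` in the local coordinates around `x`. -/
def jetEquiv (x : M) : Jet E L x ≃ₗ[ℝ] (jetModel E L).V x :=
  (Submodule.quotEquivOfEq _ _ (vanishing_eq_ker x)).trans
    ((jetL (L := L) (mem_base (E := E) x)).quotKerEquivOfSurjective
      (jetC_surjective (mem_base x)))

variable (E L) in
/-- The first jet bundle `J¹L`, with fibres `Jet E L x`. -/
def jetBundle : SmoothVB.{u, u} 𝓘(ℝ, E) M :=
  (jetModel E L).transport (Jet E L) (jetEquiv E L)


variable (E L) in
/-- The line bundle `L` itself. -/
def lineVB : SmoothVB.{u, u} 𝓘(ℝ, E) M where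
  F := ℝ
  V := L
  tagV := SmoothVB.fibre_isTopologicalAddGroup (F := ℝ) L
  smulV := SmoothVB.fibre_continuousSMul (F := ℝ) L

instance : FiniteDimensional ℝ (jetBundle E L).F :=
  inferInstanceAs (FiniteDimensional ℝ (ℝ × (E →L[ℝ] ℝ)))

variable (E L) in
lemma exists_vector (ξ : (E →L[ℝ] ℝ) →ₗ[ℝ] ℝ) : ∃ v : E, ∀ α, ξ α = α v := by
  obtain ⟨v, hv⟩ := (Module.evalEquiv ℝ E).surjective
    (ξ ∘ₗ (LinearMap.toContinuousLinearMap (𝕜 := ℝ) (E := E) (F' := ℝ)).toLinearMap)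
  refine ⟨v, fun α => ?_⟩
  have h := LinearMap.congr_fun hv α.toLinearMap
  exact h.symm

lemma hom_hasSymbol {x : M} (A : Jet E L x →ₗ[ℝ] L x) :
    ∃ v, HasSymbol (A ∘ₗ jet x) v := by
  have hx := mem_base (E := E) (L := L) x
  let e := ((trivializationAt ℝ L x).continuousLinearEquivAt ℝ x hx.2).toLinearEquiv
  let A' : (ℝ × (E →L[ℝ] ℝ)) →ₗ[ℝ] L x := A ∘ₗ (jetEquiv E L x).symm.toLinearMap
  have hA' : ∀ s, A (jet x s) = A' (jetC x x s) := fun s =>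
    congrArg A ((jetEquiv E L x).symm_apply_apply (jet x s)).symm
  obtain ⟨v, hv⟩ := exists_vector E
    (e.toLinearMap ∘ₗ A' ∘ₗ LinearMap.inr ℝ ℝ (E →L[ℝ] ℝ))
  refine ⟨v, fun f s => ?_⟩
  have h1 : A' (0, loc x s x • fderiv ℝ (f ∘ (chartAt E x).symm) (chartAt E x x)) =
      (fderiv ℝ (f ∘ (chartAt E x).symm) (chartAt E x x) v) • s x := by
    apply e.injective
    refine (hv _).trans ?_
    refine Eq.trans ?_ (map_smul e _ _).symm
    exact mul_comm _ _
  simp only [LinearMap.comp_apply]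
  rw [hA', hA', jetC_fsmul hx, map_add, map_smul, h1, add_comm,
    mfderiv_eq_fderiv (f.contMDiff.mdifferentiableAt (by simp))]
  rfl

lemma der_vanishing {x : M} {Δ : Sec E L →ₗ[ℝ] L x} {v : TangentSpace 𝓘(ℝ, E) x}
    (hΔ : HasSymbol Δ v) {s : Sec E L} (hs : s ∈ vanishing E L x) : Δ s = 0 := by
  obtain ⟨hs0, hs1⟩ := hs
  obtain ⟨χ, h1, hχ⟩ := exists_bump (E := E) (isOpen_base (E := E) (L := L) x) (mem_base x)
  have hu : ContMDiff 𝓘(ℝ, E) 𝓘(ℝ, ℝ) ∞ (fun y => χ y * loc x s y) := by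
    refine contMDiff_of_tsupport fun y hy => ?_
    have hy' : y ∈ base E L x := hχ (tsupport_mul_subset_left hy)
    exact χ.contMDiff.contMDiffAt.mul
      ((contMDiffOn_loc x s).contMDiffAt ((isOpen_base x).mem_nhds hy'))
  let f : C^∞⟮𝓘(ℝ, E), M; ℝ⟯ := ⟨_, hu⟩
  have hfs : fsmul f (cutSec x χ hχ (fun _ => 1) contMDiffOn_const) = fsmul (χ * χ) s := by
    ext y
    by_cases hy : y ∈ base E L x
    · have h2 : (trivializationAt ℝ L x).symm y (loc x s y) = s y :=
        (trivializationAt ℝ L x).symm_apply_apply_mk hy.2 (s y)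
      have h3 : loc x s y • (trivializationAt ℝ L x).symm y 1 = s y := by
        have h4 : (trivializationAt ℝ L x).symm y (loc x s y • 1) =
            loc x s y • (trivializationAt ℝ L x).symm y 1 :=
          by simpa only [Trivialization.coe_symmₗ (hb := hy.2)] using
            ((trivializationAt ℝ L x).symmₗ ℝ y).map_smul (loc x s y) 1
        rw [smul_eq_mul, mul_one] at h4
        exact h4.symm.trans h2
      change (χ y * loc x s y) • χ y • (trivializationAt ℝ L x).symm y 1 = (χ y * χ y) • s y
      rw [← h3, smul_smul, smul_smul]
      congr 1
      ring
    · have h0 : χ y = 0 := image_eq_zero_of_notMem_tsupport fun h => hy (hχ h)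
      change (χ y * loc x s y) • _ = (χ y * χ y) • s y
      simp [h0]
  have e1 := hΔ f (cutSec x χ hχ (fun _ => 1) contMDiffOn_const)
  have e2 := hΔ (χ * χ) s
  have hloc : loc x s x = 0 := by
    have := ((trivializationAt ℝ L x).continuousLinearEquivAt ℝ x
      (mem_base (E := E) x).2).map_zero
    rw [← hs0] at this
    exact this
  have hf0 : f x = 0 := by
    change χ x * loc x s x = 0
    rw [hloc, mul_zero]
  have hf1 : mfderiv 𝓘(ℝ, E) 𝓘(ℝ, ℝ) f x = 0 := by
    have : (f : M → ℝ) =ᶠ[𝓝 x] loc x s := by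
      filter_upwards [h1] with y hy
      change χ y * loc x s y = _
      rw [hy, one_mul]
    rw [this.mfderiv_eq]
    exact hs1
  have hχx : (χ * χ) x = 1 := by
    change χ x * χ x = 1
    rw [h1.self_of_nhds, one_mul]
  rw [hfs, e2, hs0, hχx, hf0, hf1, smul_zero, zero_add, one_smul, zero_smul, add_zero] at e1
  exact e1.trans (zero_smul ℝ _)

variable (E L) in
/-- Composition with `jet x`, as a map from `Hom(J¹L, L)` at `x` to derivations at `x`. -/
def homToDer (x : M) : ((jetBundle E L).V x →L[ℝ] (lineVB E L).V x) →ₗ[ℝ] Der E L x where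
  toFun A := ⟨(show Jet E L x →ₗ[ℝ] L x from A.toLinearMap) ∘ₗ jet x, hom_hasSymbol _⟩
  map_add' _ _ := rfl
  map_smul' _ _ := rfl

lemma homToDer_bijective (x : M) : Function.Bijective (homToDer E L x) := by
  constructor
  · intro A A' h
    ext j
    obtain ⟨s, rfl⟩ := (vanishing E L x).mkQ_surjective j
    exact LinearMap.congr_fun (congrArg Subtype.val h) s
  · rintro ⟨Δ, v, hv⟩
    let A : (jetBundle E L).V x →ₗ[ℝ] (lineVB E L).V x :=
      (vanishing E L x).liftQ Δ fun s hs => der_vanishing hv hs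
    exact ⟨⟨A, SmoothVB.continuous_of_fibre _ A⟩, rfl⟩

variable (E L) in
/-- The gauge algebroid `DL`, with fibres `Der E L x`, as a vector bundle. -/
def derBundle : SmoothVB.{u, u} 𝓘(ℝ, E) M :=
  ((jetBundle E L).hom (lineVB E L)).transport (fun x => Der E L x)
    fun x => (LinearEquiv.ofBijective (homToDer E L x) (homToDer_bijective x)).symm

variable (E L) in
/-- The bundle of Atiyah `(l, m)`-tensors: maps `DL × ⋯ × DL × J¹L × ⋯ × J¹L → L`
(with `l` factors `DL` and `m` factors `J¹L`) linear in each argument. -/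
def atiyah (l m : ℕ) : SmoothVB.{u, u} 𝓘(ℝ, E) M :=
  (derBundle E L).multi ((jetBundle E L).multi (lineVB E L) m) l


variable (L) in
/-- The fibres of the dual line bundle `L*`. -/
abbrev Dual (x : M) : Type u := L x →L[ℝ] Bundle.Trivial M ℝ x

variable (L) in
/-- The total space of the dual line bundle `L*`. -/
abbrev DualTotal : Type u := TotalSpace (ℝ →L[ℝ] ℝ) (Dual L)

variable (L) in
/-- The slit dual `L* ∖ 0`: the total space of `L*` with the zero section removed, as an open
submanifold of `L*`. -/
def slitDual : TopologicalSpace.Opens (DualTotal L) where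
  carrier := {ε | ε.2 ≠ 0}
  is_open' := by
    rw [isOpen_iff_mem_nhds]
    intro ε hε
    let e := trivializationAt (ℝ →L[ℝ] ℝ) (Dual L) ε.1
    have hU : IsOpen (e.source ∩ e ⁻¹' (univ ×ˢ {0}ᶜ)) :=
      e.continuousOn_toFun.isOpen_inter_preimage e.open_source
        (isOpen_univ.prod isOpen_compl_singleton)
    have key : ∀ η : DualTotal L, η ∈ e.source → ((e η).2 = 0 ↔ η.2 = 0) := by
      intro η hη
      have hb : η.1 ∈ e.baseSet := e.mem_source.1 hη
      exact (e.continuousLinearEquivAt ℝ η.1 hb).map_eq_zero_iff (x := η.2)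
    have hsrc : ε ∈ e.source :=
      e.mem_source.2 (FiberBundle.mem_baseSet_trivializationAt' ε.1)
    refine Filter.mem_of_superset (hU.mem_nhds ⟨hsrc, mem_univ _, ?_⟩) ?_
    · exact fun h => hε ((key ε hsrc).1 h)
    · rintro η ⟨hη, -, h⟩
      exact fun h0 => h ((key η hη).2 h0)

variable (E) in
/-- The model with corners of the manifold `L*`, hence of `L* ∖ 0`. -/
abbrev slitModel : ModelWithCorners ℝ (E × (ℝ →L[ℝ] ℝ)) (ModelProd E (ℝ →L[ℝ] ℝ)) :=
  𝓘(ℝ, E).prod 𝓘(ℝ, ℝ →L[ℝ] ℝ)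

variable (E L) in
/-- The bundle projection `p : L* ∖ 0 → M`. -/
def proj : ContMDiffMap (slitModel E) 𝓘(ℝ, E) (slitDual L) M ∞ :=
  ⟨fun ε => ε.1.1, (Bundle.contMDiff_proj (Dual L)).comp contMDiff_subtype_val⟩

/-- The action `h_r` of a non-zero real number `r` on `L* ∖ 0`. -/
def scale (r : ℝˣ) (ε : slitDual L) : slitDual L :=
  ⟨⟨ε.1.1, (r : ℝ) • ε.1.2⟩, smul_ne_zero r.ne_zero ε.2⟩

/-- The homogenization of a section `s` of `L`: the function `ε ↦ ⟨ε, s⟩` on `L* ∖ 0`. -/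
def homogenize (s : Sec E L) (ε : slitDual L) : ℝ := ε.1.2 (s ε.1.1)

variable (E L) in
/-- The bundle of `(l, m)`-tensors on `L* ∖ 0`: maps
`T × ⋯ × T × T* × ⋯ × T* → ℝ` (with `l` tangent and `m` cotangent factors) linear in each
argument. -/
def tensors (l m : ℕ) : SmoothVB.{u, 0} (slitModel E) (slitDual L) :=
  (SmoothVB.tangent _ _).multi
    ((SmoothVB.cotangent _ _).multi (SmoothVB.trivialLine _ _) m) l

variable (E L) in
/-- The value of an `(l, m)`-tensor on `l` tangent vectors and `m` covectors at a point. -/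
def tensorEval (l m : ℕ) {ε : slitDual L} (T : (tensors E L l m).V ε)
    (v : Fin l → TangentSpace (slitModel E) ε)
    (θ : Fin m → (TangentSpace (slitModel E) ε →L[ℝ] ℝ)) : ℝ :=
  SmoothVB.eval (SmoothVB.cotangent (slitModel E) (slitDual L)) (SmoothVB.trivialLine _ _) m
    (SmoothVB.eval (SmoothVB.tangent _ _) _ l T v) θ

variable (E L) in
/-- The value of an Atiyah `(l, m)`-tensor on `l` derivations and `m` jets at a point. -/
def atiyahEval (l m : ℕ) {x : M} (T : (atiyah E L l m).V x)
    (Δ : Fin l → Der E L x) (ψ : Fin m → Jet E L x) : L x :=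
  SmoothVB.eval (jetBundle E L) (lineVB E L) m
    (SmoothVB.eval (derBundle E L) _ l T Δ) ψ

variable (E L) in
/-- The differential of `h_r`. -/
def dscale (r : ℝˣ) (ε : slitDual L) :
    TangentSpace (slitModel E) ε →L[ℝ] TangentSpace (slitModel E) (scale r ε) :=
  mfderiv (slitModel E) (slitModel E) (scale r) ε

/-- `𝒮 = h_r^* 𝒯`: the tensors agree after pushing vectors forward along the diffeomorphism `h_r`
and pulling covectors back along it. -/
def IsPullback {l m : ℕ} (r : ℝˣ) (𝒮 𝒯 : (tensors E L l m).Sec) : Prop :=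
  ∀ (ε : slitDual L) (v : Fin l → TangentSpace (slitModel E) ε)
    (η : Fin m → (TangentSpace (slitModel E) (scale r ε) →L[ℝ] ℝ)),
    tensorEval E L l m (𝒮 ε) v (fun j => (η j).comp (dscale E L r ε)) =
      tensorEval E L l m (𝒯 (scale r ε)) (fun i => dscale E L r ε (v i)) η

/-- Homogeneous `(l, m)`-tensors on `L* ∖ 0`: those with `h_r^* 𝒯 = r ^ (1 - m) 𝒯` for all
`r ≠ 0`. -/
def IsHomogeneous {l m : ℕ} (𝒯 : (tensors E L l m).Sec) : Prop :=
  ∀ r : ℝˣ, IsPullback r ((r : ℝ) ^ (1 - (m : ℤ)) • 𝒯) 𝒯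

end
end LineBundle

end

open LineBundle

/-! Near a point of `M` choose a local frame of `L` and write a section as `f` times the frame. With
`t = fibreCoord` the matching fibre coordinate on `L* ∖ 0`, the homogenization is `t · (f ∘ p)`, so
its differential is `t · d(f ∘ p) + (f ∘ p) · dt` (`mfderiv_homogenize`). Everything rests on this
formula.

If the 1-jet of the section vanishes at `p(ε)`, both terms vanish at `ε`, so the differential of the
homogenization depends on the jet alone. Conversely, suppose the differential vanishes at `ε`.
Contracting it with the Euler field gives back the value of the homogenization, hence `f = 0` at the
base point; then `t ≠ 0` and the surjectivity of `dp` give `df = 0` (`mem_vanishing_of_diff`). The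
map from `J¹L` at `p(ε)` to the cotangent space at `ε` is thus injective, and both spaces have
dimension `dim M + 1`. Local frames of jets go to smooth families of covectors, so the fibrewise
isomorphisms form a bundle isomorphism (`jetIso`), whose inverse is the required map on covectors.

Pairing with `ε` trivializes `p*L` (`lineIso`), and `DL` is `Hom(J¹L, L)`. Hence `T ≅ T** ≅
p*Hom(J¹L, L) ≅ p*DL` (`tangentIso`), and conjugation by these isomorphisms in every slot gives the
isomorphism on tensors (`tensorIso`).

The homogenization of a section is multiplied by `r` under `h_r`. Therefore the tangent isomorphism
is unchanged by `dh_r`, each pulled-back covector contributes a factor `r`, and so does the pairing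
with `rε`. The weight `r ^ (1 - m)` is exactly the one that balances these factors: homogeneous
tensors are the invariant sections of the pull-back bundle (`isHomogeneous_iff`). Since the non-zero
reals act transitively on the fibres of `p`, invariant sections descend to `M`, smoothly because `p`
has smooth local sections (`exists_atiyah_section`). -/

noncomputable section

namespace SmoothVB

/-! ### Smooth families of vectors in a bundle, over a map to the base -/

section Families

variable {E H : Type} [NormedAddCommGroup E] [NormedSpace ℝ E] [TopologicalSpace H]
  {I : ModelWithCorners ℝ E H} {B : Type u} [TopologicalSpace B] [ChartedSpace H B]
  {EX HX : Type} [NormedAddCommGroup EX] [NormedSpace ℝ EX] [TopologicalSpace HX]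
  {IX : ModelWithCorners ℝ EX HX} {X : Type*} [TopologicalSpace X] [ChartedSpace HX X]

/-- The family of vectors `a x` of the bundle `A` over the points `b x` is smooth at `x₀`. -/
def SmoothAt (A : SmoothVB.{u, v} I B) (IX : ModelWithCorners ℝ EX HX) {b : X → B}
    (a : ∀ x, A.V (b x)) (x₀ : X) : Prop :=
  ContMDiffAt IX (I.prod 𝓘(ℝ, A.F)) ∞ (fun x => (⟨b x, a x⟩ : TotalSpace A.F A.V)) x₀

/-- The coordinate of a vector of `A` in the preferred trivialization around `i`. -/
def coord (A : SmoothVB.{u, v} I B) (i : B) {y : B} (a : A.V y) : A.F :=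
  (trivializationAt A.F A.V i ⟨y, a⟩).2

/-- The vector over `y` with coordinate `w` in the preferred trivialization around `i`. -/
def frame (A : SmoothVB.{u, v} I B) (i : B) (w : A.F) (y : B) : A.V y :=
  (trivializationAt A.F A.V i).symm y w

/-- The domain of the preferred trivialization around `i`. -/
def dom (A : SmoothVB.{u, v} I B) (i : B) : Set B := (trivializationAt A.F A.V i).baseSet

lemma dom_mem_nhds (A : SmoothVB.{u, v} I B) (i : B) : A.dom i ∈ 𝓝 i :=
  (trivializationAt A.F A.V i).open_baseSet.mem_nhds (FiberBundle.mem_baseSet_trivializationAt' i)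

lemma mem_dom (A : SmoothVB.{u, v} I B) (i : B) : i ∈ A.dom i :=
  FiberBundle.mem_baseSet_trivializationAt' i

lemma coord_frame (A : SmoothVB.{u, v} I B) {i y : B} (hy : y ∈ A.dom i) (w : A.F) :
    A.coord i (A.frame i w y) = w := by
  simp only [coord, frame]
  rw [(trivializationAt A.F A.V i).apply_mk_symm hy]

lemma frame_coord (A : SmoothVB.{u, v} I B) {i y : B} (hy : y ∈ A.dom i) (a : A.V y) :
    A.frame i (A.coord i a) y = a :=
  (trivializationAt A.F A.V i).symm_apply_apply_mk hy a

/-- The coordinates of the preferred trivialization around `i`, as a continuous linear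
equivalence. -/
def coordCLE (A : SmoothVB.{u, v} I B) {i y : B} (hy : y ∈ A.dom i) : A.V y ≃L[ℝ] A.F :=
  (trivializationAt A.F A.V i).continuousLinearEquivAt ℝ y hy

lemma coordCLE_apply (A : SmoothVB.{u, v} I B) {i y : B} (hy : y ∈ A.dom i) (a : A.V y) :
    A.coordCLE hy a = A.coord i a := rfl

lemma coordCLE_symm_apply (A : SmoothVB.{u, v} I B) {i y : B} (hy : y ∈ A.dom i) (w : A.F) :
    (A.coordCLE hy).symm w = A.frame i w y := by
  rw [ContinuousLinearEquiv.symm_apply_eq, coordCLE_apply, coord_frame A hy]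

lemma coord_add (A : SmoothVB.{u, v} I B) {i y : B} (hy : y ∈ A.dom i) (a a' : A.V y) :
    A.coord i (a + a') = A.coord i a + A.coord i a' := (A.coordCLE hy).map_add a a'

lemma coord_smul (A : SmoothVB.{u, v} I B) {i y : B} (hy : y ∈ A.dom i) (c : ℝ) (a : A.V y) :
    A.coord i (c • a) = c • A.coord i a := (A.coordCLE hy).map_smul c a

variable {A : SmoothVB.{u, v} I B} {C : SmoothVB.{u, v} I B} {b : X → B} {x₀ : X}

lemma smoothAt_iff {a : ∀ x, A.V (b x)} : A.SmoothAt IX a x₀ ↔ ContMDiffAt IX I ∞ b x₀ ∧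
    ContMDiffAt IX 𝓘(ℝ, A.F) ∞ (fun x => A.coord (b x₀) (a x)) x₀ :=
  contMDiffAt_totalSpace

lemma SmoothAt.base {a : ∀ x, A.V (b x)} (h : A.SmoothAt IX a x₀) : ContMDiffAt IX I ∞ b x₀ :=
  (smoothAt_iff.1 h).1

lemma SmoothAt.coord {a : ∀ x, A.V (b x)} (h : A.SmoothAt IX a x₀) :
    ContMDiffAt IX 𝓘(ℝ, A.F) ∞ (fun x => A.coord (b x₀) (a x)) x₀ :=
  (smoothAt_iff.1 h).2

lemma SmoothAt.congr {a a' : ∀ x, A.V (b x)} (h : A.SmoothAt IX a x₀)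
    (he : ∀ᶠ x in 𝓝 x₀, a' x = a x) : A.SmoothAt IX a' x₀ :=
  ContMDiffAt.congr_of_eventuallyEq h (he.mono fun x hx => by simp only [hx])

lemma eventually_mem_dom (hb : ContMDiffAt IX I ∞ b x₀) : ∀ᶠ x in 𝓝 x₀, b x ∈ A.dom (b x₀) :=
  hb.continuousAt.eventually (A.dom_mem_nhds (b x₀))

lemma smoothAt_frame (A : SmoothVB.{u, v} I B) (hb : ContMDiffAt IX I ∞ b x₀) (w : A.F) :
    A.SmoothAt IX (fun x => A.frame (b x₀) w (b x)) x₀ :=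
  smoothAt_iff.2 ⟨hb, contMDiffAt_const.congr_of_eventuallyEq
    ((eventually_mem_dom hb).mono fun _ hx => A.coord_frame hx w)⟩

lemma SmoothAt.add {a a' : ∀ x, A.V (b x)} (h : A.SmoothAt IX a x₀) (h' : A.SmoothAt IX a' x₀) :
    A.SmoothAt IX (fun x => a x + a' x) x₀ :=
  smoothAt_iff.2 ⟨h.base, (h.coord.add h'.coord).congr_of_eventuallyEq
    ((eventually_mem_dom h.base).mono fun _ hx => A.coord_add hx _ _)⟩

lemma SmoothAt.smul {c : X → ℝ} {a : ∀ x, A.V (b x)} (hc : ContMDiffAt IX 𝓘(ℝ, ℝ) ∞ c x₀)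
    (h : A.SmoothAt IX a x₀) : A.SmoothAt IX (fun x => c x • a x) x₀ :=
  smoothAt_iff.2 ⟨h.base, (hc.smul h.coord).congr_of_eventuallyEq
    ((eventually_mem_dom h.base).mono fun _ hx => A.coord_smul hx _ _)⟩

lemma smoothAt_section (s : A.Sec) (hb : ContMDiffAt IX I ∞ b x₀) :
    A.SmoothAt IX (fun x => s (b x)) x₀ :=
  (s.contMDiff.contMDiffAt (x := b x₀)).comp x₀ hb

/-- A family of continuous linear maps on a finite dimensional space is smooth if its values at
all vectors are. -/
lemma contMDiffAt_clm_of_apply {F G : Type} [NormedAddCommGroup F] [NormedSpace ℝ F]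
    [FiniteDimensional ℝ F] [NormedAddCommGroup G] [NormedSpace ℝ G] {φ : X → F →L[ℝ] G}
    (h : ∀ w, ContMDiffAt IX 𝓘(ℝ, G) ∞ (fun x => φ x w) x₀) :
    ContMDiffAt IX 𝓘(ℝ, F →L[ℝ] G) ∞ φ x₀ := by
  -- A basis of `F` identifies a linear map with the tuple of its values on the basis, so smoothness
  -- is checked on finitely many vectors.
  let e : F ≃L[ℝ] (Fin (Module.finrank ℝ F) → ℝ) :=
    ContinuousLinearEquiv.ofFinrankEq (by simp)
  let e' : (F →L[ℝ] G) ≃L[ℝ] (Fin (Module.finrank ℝ F) → G) :=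
    (e.arrowCongr (.refl ℝ G)).trans (ContinuousLinearEquiv.piRing _)
  have h2 : ContMDiffAt IX 𝓘(ℝ, Fin (Module.finrank ℝ F) → G) ∞ (fun x => e' (φ x)) x₀ :=
    contMDiffAt_pi_space.2 fun i => h _
  have h3 := (e'.symm.contDiff.contMDiff.contMDiffAt (n := ∞)).comp x₀ h2
  exact h3.congr_of_eventuallyEq (.of_forall fun x => (e'.symm_apply_apply (φ x)).symm)

/-- A family of linear maps between fibres of smooth vector bundles is smooth if it takes the
local frames to smooth families. -/
lemma smoothAt_hom_of_frame [FiniteDimensional ℝ A.F] (hb : ContMDiffAt IX I ∞ b x₀)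
    {φ : ∀ x, A.V (b x) →L[ℝ] C.V (b x)}
    (h : ∀ w, C.SmoothAt IX (fun x => φ x (A.frame (b x₀) w (b x))) x₀) :
    (hom A C).SmoothAt IX φ x₀ := by
  refine (contMDiffAt_hom_bundle (F₁ := A.F) (F₂ := C.F) (E₁ := A.V) (E₂ := C.V)
    (fun x => ⟨b x, φ x⟩)).2 ⟨hb, contMDiffAt_clm_of_apply fun w => ?_⟩
  refine (h w).coord.congr_of_eventuallyEq ?_
  filter_upwards [eventually_mem_dom (A := A) hb, eventually_mem_dom (A := C) hb] with x hA hC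
  rw [ContinuousLinearMap.inCoordinates_eq hA hC]
  simp only [ContinuousLinearMap.coe_comp, ContinuousLinearEquiv.coe_coe, Function.comp_apply]
  have := A.coordCLE_symm_apply hA w
  rw [← this]
  rfl

lemma SmoothAt.apply {φ : ∀ x, A.V (b x) →L[ℝ] C.V (b x)} {a : ∀ x, A.V (b x)}
    (h : (hom A C).SmoothAt IX φ x₀) (ha : A.SmoothAt IX a x₀) :
    C.SmoothAt IX (fun x => φ x (a x)) x₀ :=
  ContMDiffAt.clm_bundle_apply (F₁ := A.F) (F₂ := C.F) (E₁ := A.V) (E₂ := C.V)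
    (IB := I) (b := b) (ϕ := φ) (v := a) h ha

lemma smoothAt_trivialLine_iff {c : X → ℝ} :
    (trivialLine I B).SmoothAt IX (b := b) c x₀ ↔
      ContMDiffAt IX I ∞ b x₀ ∧ ContMDiffAt IX 𝓘(ℝ, ℝ) ∞ c x₀ :=
  smoothAt_iff

/-- The trivializations of the transported bundle are those of `A` composed with `Φ`, so the two
local coordinates agree by definition. -/
lemma smoothAt_transport_iff {A : SmoothVB.{u, v} I B} {V' : B → Type w}
    [∀ x, AddCommGroup (V' x)] [∀ x, Module ℝ (V' x)] {Φ : ∀ x, V' x ≃ₗ[ℝ] A.V x}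
    {a : ∀ x, V' (b x)} :
    (A.transport V' Φ).SmoothAt IX (b := b) a x₀ ↔ A.SmoothAt IX (fun x => Φ (b x) (a x)) x₀ :=
  (smoothAt_iff (A := A.transport V' Φ) (a := a)).trans (smoothAt_iff (A := A)).symm

end Families

/-! ### Bundle isomorphisms and their construction from fibrewise ones -/

section Isomorphisms

universe u' v'

variable {E H : Type} [NormedAddCommGroup E] [NormedSpace ℝ E] [TopologicalSpace H]
  {I : ModelWithCorners ℝ E H} {B : Type u} [TopologicalSpace B] [ChartedSpace H B]
  {E' H' : Type} [NormedAddCommGroup E'] [NormedSpace ℝ E'] [TopologicalSpace H']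
  {I' : ModelWithCorners ℝ E' H'} {B' : Type u'} [TopologicalSpace B'] [ChartedSpace H' B']
  {EX HX : Type} [NormedAddCommGroup EX] [NormedSpace ℝ EX] [TopologicalSpace HX]
  {IX : ModelWithCorners ℝ EX HX} {X : Type*} [TopologicalSpace X] [ChartedSpace HX X] {x₀ : X}

/-- The coordinates around `i` in the pull-back are those of `A` around `f i`. Only the base
condition differs: smoothness of `f ∘ b` does not give that of `b`. -/
lemma smoothAt_pullback_iff {A : SmoothVB.{u, v} I B} {f : ContMDiffMap I' I B' B ∞} {b : X → B'}
    {a : ∀ x, A.V (f (b x))} :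
    (A.pullback f).SmoothAt IX (b := b) a x₀ ↔
      ContMDiffAt IX I' ∞ b x₀ ∧ A.SmoothAt IX (b := fun x => f (b x)) a x₀ := by
  have h1 := smoothAt_iff (IX := IX) (x₀ := x₀) (A := A.pullback f) (b := b) (a := a)
  have h2 := smoothAt_iff (IX := IX) (x₀ := x₀) (A := A) (b := fun x => f (b x)) (a := a)
  rw [h1, h2]
  exact ⟨fun h => ⟨h.1, f.contMDiff.contMDiffAt.comp x₀ h.1, h.2⟩, fun h => ⟨h.1, h.2.2⟩⟩

lemma frame_pullback (A : SmoothVB.{u, v} I B) {f : ContMDiffMap I' I B' B ∞} {i x : B'}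
    (hx : f x ∈ A.dom (f i)) (w : A.F) :
    (A.pullback f).frame i w x = A.frame (f i) w (f x) := by
  refine (A.coordCLE hx).injective ?_
  exact ((A.pullback f).coord_frame (i := i) (y := x) hx w).trans (A.coord_frame hx w).symm

/-- This is the universal smooth family: a bundle map is smooth on the total space once it takes
smooth families to smooth families. -/
lemma smoothAt_tautological (A : SmoothVB.{u, v} I B) (p₀ : TotalSpace A.F A.V) :
    A.SmoothAt (I.prod 𝓘(ℝ, A.F)) (b := TotalSpace.proj) (fun p => p.2) p₀ :=
  contMDiffAt_id

variable {A : SmoothVB.{u, v} I B} {C : SmoothVB.{u, w} I B}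

lemma Iso.smoothAt (φ : Iso A C) {b : X → B} {a : ∀ x, A.V (b x)} (h : A.SmoothAt IX a x₀) :
    C.SmoothAt IX (fun x => φ.toFun (b x) (a x)) x₀ :=
  ContMDiffAt.comp (g := fun p : TotalSpace A.F A.V => (⟨p.1, φ.toFun p.1 p.2⟩ :
    TotalSpace C.F C.V)) x₀ φ.smooth_toFun.contMDiffAt h

lemma Iso.smoothAt_symm (φ : Iso A C) {b : X → B} {c : ∀ x, C.V (b x)} (h : C.SmoothAt IX c x₀) :
    A.SmoothAt IX (fun x => (φ.toFun (b x)).symm (c x)) x₀ :=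
  ContMDiffAt.comp (g := fun p : TotalSpace C.F C.V => (⟨p.1, (φ.toFun p.1).symm p.2⟩ :
    TotalSpace A.F A.V)) x₀ φ.smooth_invFun.contMDiffAt h

/-- The inverse isomorphism. -/
def Iso.symm (φ : Iso A C) : Iso C A where
  toFun x := (φ.toFun x).symm
  smooth_toFun := φ.smooth_invFun
  smooth_invFun := φ.smooth_toFun

/-- The composition of isomorphisms. -/
def Iso.trans {D : SmoothVB.{u, v'} I B} (φ : Iso A C) (ψ : Iso C D) : Iso A D where
  toFun x := (φ.toFun x).trans (ψ.toFun x)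
  smooth_toFun := ψ.smooth_toFun.comp φ.smooth_toFun
  smooth_invFun := φ.smooth_invFun.comp ψ.smooth_invFun

/-- The pull-back of an isomorphism. -/
def Iso.pullback (φ : Iso A C) (f : ContMDiffMap I' I B' B ∞) :
    Iso (A.pullback f) (C.pullback f) where
  toFun x := φ.toFun (f x)
  smooth_toFun p₀ := smoothAt_pullback_iff.2 ⟨contMDiffAt_proj _, φ.smoothAt
    (smoothAt_pullback_iff.1 ((A.pullback f).smoothAt_tautological p₀)).2⟩
  smooth_invFun p₀ := smoothAt_pullback_iff.2 ⟨contMDiffAt_proj _, φ.smoothAt_symm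
    (smoothAt_pullback_iff.1 ((C.pullback f).smoothAt_tautological p₀)).2⟩

/-- The isomorphism from a transported bundle. -/
def transportIso (A : SmoothVB.{u, v} I B) (V' : B → Type w)
    [∀ x, AddCommGroup (V' x)] [∀ x, Module ℝ (V' x)] (Φ : ∀ x, V' x ≃ₗ[ℝ] A.V x) :
    Iso (A.transport V' Φ) A where
  toFun x :=
    { toLinearEquiv := Φ x
      continuous_toFun := continuous_induced_dom
      continuous_invFun := continuous_induced_rng.2 (by
        refine continuous_id.congr fun a => ?_
        exact ((Φ x).apply_symm_apply a).symm) }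
  smooth_toFun p₀ := smoothAt_transport_iff (b := TotalSpace.proj)
    (X := TotalSpace (A.transport V' Φ).F (A.transport V' Φ).V) (a := fun p => p.2) |>.1
      ((A.transport V' Φ).smoothAt_tautological p₀)
  smooth_invFun p₀ := smoothAt_transport_iff (b := TotalSpace.proj)
    (a := fun p : TotalSpace A.F A.V => (Φ p.1).symm p.2) |>.2 (by
    refine (A.smoothAt_tautological p₀).congr (.of_forall fun p => ?_)
    exact (Φ p.1).apply_symm_apply p.2)

/-- A linear map between fibres, in local coordinates around `i`. -/
def inCoord [FiniteDimensional ℝ A.F] (φ : ∀ x, A.V x →ₗ[ℝ] C.V x) (i x : B) : A.F →L[ℝ] C.F :=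
  LinearMap.toContinuousLinearMap
    ((trivializationAt C.F C.V i).linearMapAt ℝ x ∘ₗ φ x ∘ₗ
      (trivializationAt A.F A.V i).symmₗ ℝ x)

lemma inCoord_apply [FiniteDimensional ℝ A.F] (φ : ∀ x, A.V x →ₗ[ℝ] C.V x) {i x : B}
    (hA : x ∈ A.dom i) (hC : x ∈ C.dom i) (w : A.F) :
    inCoord φ i x w = C.coord i (φ x (A.frame i w x)) := by
  have h1 : (trivializationAt A.F A.V i).symmₗ ℝ x w = A.frame i w x := by
    rw [Trivialization.coe_symmₗ (hb := hA)]
    rfl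
  change (trivializationAt C.F C.V i).linearMapAt ℝ x (φ x _) = _
  rw [h1, Trivialization.coe_linearMapAt_of_mem _ hC]
  rfl

lemma contMDiffAt_inCoord [FiniteDimensional ℝ A.F] {φ : ∀ x, A.V x →ₗ[ℝ] C.V x} {i : B}
    (h : ∀ w, C.SmoothAt I (b := fun x => x) (fun x => φ x (A.frame i w x)) i) :
    ContMDiffAt I 𝓘(ℝ, A.F →L[ℝ] C.F) ∞ (inCoord φ i) i := by
  refine contMDiffAt_clm_of_apply fun w => (h w).coord.congr_of_eventuallyEq ?_
  filter_upwards [A.dom_mem_nhds i, C.dom_mem_nhds i] with x hA hC using inCoord_apply φ hA hC w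

/-- A fibrewise linear map which takes the local frames to smooth families is smooth. -/
lemma smoothAt_of_frame [FiniteDimensional ℝ A.F] {φ : ∀ x, A.V x →ₗ[ℝ] C.V x}
    (h : ∀ i w, C.SmoothAt I (b := fun x => x) (fun x => φ x (A.frame i w x)) i) {b : X → B}
    {a : ∀ x, A.V (b x)} (ha : A.SmoothAt IX a x₀) :
    C.SmoothAt IX (fun x => φ (b x) (a x)) x₀ := by
  refine smoothAt_iff.2 ⟨ha.base, ?_⟩
  have h1 := ((contMDiffAt_inCoord (h (b x₀))).comp x₀ ha.base).clm_apply ha.coord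
  refine h1.congr_of_eventuallyEq ?_
  filter_upwards [eventually_mem_dom (A := A) ha.base, eventually_mem_dom (A := C) ha.base]
    with x hA hC
  rw [Function.comp_apply, inCoord_apply φ hA hC, frame_coord A hA]

/-- In local coordinates the family is a smooth map into invertible operators, and inversion of
operators is smooth there. -/
lemma smoothAt_symm_frame [FiniteDimensional ℝ A.F] [FiniteDimensional ℝ C.F]
    {φ : ∀ x, A.V x ≃ₗ[ℝ] C.V x}
    (h : ∀ i w, C.SmoothAt I (b := fun x => x) (fun x => φ x (A.frame i w x)) i) (i : B)
    (w : C.F) : A.SmoothAt I (b := fun x => x) (fun x => (φ x).symm (C.frame i w x)) i := by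
  refine smoothAt_iff.2 ⟨contMDiffAt_id, ?_⟩
  let g := inCoord (fun x => (φ x).toLinearMap) i
  have key : ∀ x (hA : x ∈ A.dom i) (hC : x ∈ C.dom i), ∃ e : A.F ≃L[ℝ] C.F, (e : A.F →L[ℝ] C.F) =
      g x ∧ ∀ w, e.symm w = A.coord i ((φ x).symm (C.frame i w x)) := by
    intro x hA hC
    let e : A.F ≃ₗ[ℝ] C.F := ((A.coordCLE hA).symm.toLinearEquiv.trans (φ x)).trans
      (C.coordCLE hC).toLinearEquiv
    refine ⟨e.toContinuousLinearEquiv, ?_, fun w => ?_⟩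
    · ext w
      refine Eq.trans ?_ (inCoord_apply _ hA hC w).symm
      change C.coord i (φ x ((A.coordCLE hA).symm w)) = _
      rw [coordCLE_symm_apply]
      rfl
    · change A.coord i ((φ x).symm ((C.coordCLE hC).symm w)) = _
      rw [coordCLE_symm_apply]
  have hg : ContMDiffAt I 𝓘(ℝ, A.F →L[ℝ] C.F) ∞ g i := contMDiffAt_inCoord (h i)
  obtain ⟨e₀, he₀, -⟩ := key i (A.mem_dom i) (C.mem_dom i)
  -- `ContinuousLinearMap.inverse` is total, with value zero at non-invertible maps; near `i` it is
  -- the true inverse by `key`.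
  have hinv : ContMDiffAt I 𝓘(ℝ, C.F →L[ℝ] A.F) ∞ (fun x => (g x).inverse) i := by
    have : CompleteSpace A.F := FiniteDimensional.complete ℝ A.F
    have h2 : ContDiffAt ℝ ∞ ContinuousLinearMap.inverse (g i) := by
      rw [← he₀]
      exact contDiffAt_map_inverse e₀
    exact h2.contMDiffAt.comp i hg
  refine (hinv.clm_apply (contMDiffAt_const (c := w))).congr_of_eventuallyEq ?_
  filter_upwards [A.dom_mem_nhds i, C.dom_mem_nhds i] with x hA hC
  obtain ⟨e, he, hs⟩ := key x hA hC
  rw [← he, ContinuousLinearMap.inverse_equiv]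
  exact (hs w).symm

/-- A family of linear isomorphisms between the fibres of vector bundles of finite rank is an
isomorphism of vector bundles if it takes the local frames to smooth families. -/
def Iso.ofLinearEquiv [FiniteDimensional ℝ A.F] [FiniteDimensional ℝ C.F]
    (φ : ∀ x, A.V x ≃ₗ[ℝ] C.V x)
    (h : ∀ i w, C.SmoothAt I (b := fun x => x) (fun x => φ x (A.frame i w x)) i) : Iso A C where
  toFun x :=
    { toLinearEquiv := φ x
      continuous_toFun := continuous_of_fibre A (φ x).toLinearMap
      continuous_invFun := continuous_of_fibre C (φ x).symm.toLinearMap }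
  smooth_toFun p₀ := smoothAt_of_frame (φ := fun x => (φ x).toLinearMap) h
    (A.smoothAt_tautological p₀)
  smooth_invFun p₀ := smoothAt_of_frame (φ := fun x => (φ x).symm.toLinearMap)
    (smoothAt_symm_frame h) (C.smoothAt_tautological p₀)

end Isomorphisms

/-! ### Multilinear maps under isomorphisms onto pull-backs -/

section Multilinear

universe u' v'

variable {E H : Type} [NormedAddCommGroup E] [NormedSpace ℝ E] [TopologicalSpace H]
  {I : ModelWithCorners ℝ E H} {B : Type u} [TopologicalSpace B] [ChartedSpace H B]
  {E' H' : Type} [NormedAddCommGroup E'] [NormedSpace ℝ E'] [TopologicalSpace H']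
  {I' : ModelWithCorners ℝ E' H'} {B' : Type u'} [TopologicalSpace B'] [ChartedSpace H' B']
  {A C : SmoothVB.{u, v} I B} {A' C' : SmoothVB.{u', v'} I' B'}
  {f : ContMDiffMap I' I B' B ∞}

/-- The isomorphism of `Hom` bundles induced by isomorphisms onto pull-backs. -/
def Iso.homPullback [FiniteDimensional ℝ A.F] [FiniteDimensional ℝ A'.F]
    (α : Iso A' (A.pullback f)) (γ : Iso C' (C.pullback f)) :
    Iso (hom A' C') ((hom A C).pullback f) where
  toFun x := (α.toFun x).arrowCongr (γ.toFun x)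
  smooth_toFun p₀ := by
    have hp : ContMDiffAt (I'.prod 𝓘(ℝ, (hom A' C').F)) I' ∞
      (TotalSpace.proj : TotalSpace (hom A' C').F (hom A' C').V → B') p₀ := contMDiffAt_proj _
    refine smoothAt_pullback_iff.2 ⟨hp, smoothAt_hom_of_frame (f.contMDiff.contMDiffAt.comp p₀ hp)
      fun w => ?_⟩
    -- The map is `T ↦ γ ∘ T ∘ α⁻¹`; it suffices to evaluate it on the frame of `A`, with `T` the
    -- tautological family.
    have h1 : (A.pullback f).SmoothAt (I'.prod 𝓘(ℝ, (hom A' C').F)) (b := TotalSpace.proj)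
        (fun p : TotalSpace (hom A' C').F (hom A' C').V => A.frame (f p₀.1) w (f p.1)) p₀ :=
      smoothAt_pullback_iff.2 ⟨hp, smoothAt_frame A (f.contMDiff.contMDiffAt.comp p₀ hp) w⟩
    exact (smoothAt_pullback_iff.1 (γ.smoothAt
      (((hom A' C').smoothAt_tautological p₀).apply (α.smoothAt_symm h1)))).2
  smooth_invFun p₀ := by
    have hp : ContMDiffAt (I'.prod 𝓘(ℝ, ((hom A C).pullback f).F)) I' ∞
      (TotalSpace.proj : TotalSpace ((hom A C).pullback f).F ((hom A C).pullback f).V → B') p₀ :=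
      contMDiffAt_proj _
    refine smoothAt_hom_of_frame hp fun w => ?_
    have h1 := (smoothAt_pullback_iff.1 (α.smoothAt (smoothAt_frame A' hp w))).2
    have h2 := (smoothAt_pullback_iff.1 (((hom A C).pullback f).smoothAt_tautological p₀)).2
    exact γ.smoothAt_symm (smoothAt_pullback_iff.2 ⟨hp, h2.apply h1⟩)

lemma Iso.homPullback_apply [FiniteDimensional ℝ A.F] [FiniteDimensional ℝ A'.F]
    (α : Iso A' (A.pullback f)) (γ : Iso C' (C.pullback f)) {x : B'}
    (T : A'.V x →L[ℝ] C'.V x) (a : A'.V x) :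
    (show A.V (f x) →L[ℝ] C.V (f x) from (α.homPullback γ).toFun x T) (α.toFun x a) =
      γ.toFun x (T a) := by
  change γ.toFun x (T ((α.toFun x).symm (α.toFun x a))) = _
  rw [ContinuousLinearEquiv.symm_apply_apply]

/-- The isomorphism of bundles of multilinear maps induced by isomorphisms onto pull-backs. -/
def Iso.multiPullback [FiniteDimensional ℝ A.F] [FiniteDimensional ℝ A'.F]
    (α : Iso A' (A.pullback f)) (γ : Iso C' (C.pullback f)) :
    (k : ℕ) → Iso (multi A' C' k) ((multi A C k).pullback f)
  | 0 => γ
  | k + 1 => α.homPullback (Iso.multiPullback α γ k)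

lemma Iso.eval_multiPullback [FiniteDimensional ℝ A.F] [FiniteDimensional ℝ A'.F]
    (α : Iso A' (A.pullback f)) (γ : Iso C' (C.pullback f)) {x : B'} (k : ℕ)
    (T : (multi A' C' k).V x) (a : Fin k → A'.V x) :
    eval A C (x := f x) k ((α.multiPullback γ k).toFun x T) (fun i => α.toFun x (a i)) =
      γ.toFun x (eval A' C' k T a) := by
  induction k with
  | zero => rfl
  | succ k ih =>
    refine Eq.trans ?_ (ih _ _)
    exact congrArg (fun S => eval A C (x := f x) k S (fun i => α.toFun x (a i.succ)))
      (α.homPullback_apply (α.multiPullback γ k) T (a 0))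

/-- Curried tensors can thus be compared through their values on vectors. -/
lemma eval_injective {x : B} (k : ℕ) {T T' : (multi A C k).V x}
    (h : ∀ a, eval A C k T a = eval A C k T' a) : T = T' := by
  induction k with
  | zero => exact h Fin.elim0
  | succ k ih =>
    refine ContinuousLinearMap.ext (R₁ := ℝ) (R₂ := ℝ) (M₁ := A.V x) (M₂ := (multi A C k).V x)
      fun a₀ => ih fun a => ?_
    exact h (Fin.cons a₀ a)

lemma eval_smul {x : B} (k : ℕ) (c : ℝ) (T : (multi A C k).V x) (a : Fin k → A.V x) :
    eval A C k (c • T) a = c • eval A C k T a := by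
  induction k with
  | zero => rfl
  | succ k ih => exact ih _ _

/-- Linearity in each slot contributes one factor `c`. This produces the `r ^ m` that the
homogeneity weight has to compensate. -/
lemma eval_smul_args {x : B} (k : ℕ) (c : ℝ) (T : (multi A C k).V x) (a : Fin k → A.V x) :
    eval A C k T (fun i => c • a i) = c ^ k • eval A C k T a := by
  induction k with
  | zero => exact (one_smul ℝ _).symm
  | succ k ih =>
    have h1 : (show A.V x →L[ℝ] (multi A C k).V x from T) (c • a 0) =
        c • (show A.V x →L[ℝ] (multi A C k).V x from T) (a 0) := ContinuousLinearMap.map_smul _ _ _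
    refine (congrArg (fun S => eval A C k S fun i => c • a i.succ) h1).trans ?_
    rw [ih, eval_smul, smul_smul, ← pow_succ]
    rfl

end Multilinear

end SmoothVB

namespace LineBundle

/-! ### The slit dual: fibre coordinate, tautological pairing, local sections -/

section SlitDual

variable {E : Type} [NormedAddCommGroup E] [NormedSpace ℝ E]
  {M : Type u} [TopologicalSpace M] [ChartedSpace E M]
  {L : M → Type u} [TopologicalSpace (TotalSpace ℝ L)] [∀ x, AddCommGroup (L x)]
  [∀ x, Module ℝ (L x)] [∀ x, TopologicalSpace (L x)] [FiberBundle ℝ L] [VectorBundle ℝ ℝ L]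
  [ContMDiffVectorBundle ∞ ℝ L 𝓘(ℝ, E)]
  {EX HX : Type} [NormedAddCommGroup EX] [NormedSpace ℝ EX] [TopologicalSpace HX]
  {IX : ModelWithCorners ℝ EX HX} {X : Type*} [TopologicalSpace X] [ChartedSpace HX X] {x₀ : X}

variable (E L) in
/-- The dual line bundle `L*`. -/
def dualVB : SmoothVB.{u, u} 𝓘(ℝ, E) M where
  F := ℝ →L[ℝ] ℝ
  V := Dual L

/-- An open submanifold carries the restricted smooth structure, so a map into `L* ∖ 0` can be
handled as a family of covectors. -/
lemma contMDiffAt_slitDual_iff {e : X → slitDual L} :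
    ContMDiffAt IX (slitModel E) ∞ e x₀ ↔
      (dualVB E L).SmoothAt IX (b := fun x => (e x).1.1) (fun x => (e x).1.2) x₀ :=
  (ContMDiffAt.subtypeVal_comp_iff (slitDual L) e x₀).symm

lemma contMDiffAt_pairing {b : X → M} {ε : ∀ x, Dual L (b x)} {a : ∀ x, L (b x)}
    (hε : (dualVB E L).SmoothAt IX ε x₀) (ha : (lineVB E L).SmoothAt IX a x₀) :
    ContMDiffAt IX 𝓘(ℝ, ℝ) ∞ (fun x => (ε x (a x) : ℝ)) x₀ := by
  have h : ContMDiffAt IX (𝓘(ℝ, E).prod 𝓘(ℝ, ℝ)) ∞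
      (fun x => (⟨b x, ε x (a x)⟩ : TotalSpace ℝ (Bundle.Trivial M ℝ))) x₀ :=
    ContMDiffAt.clm_bundle_apply (F₁ := ℝ) (F₂ := ℝ) (E₁ := L) (E₂ := Bundle.Trivial M ℝ)
      (b := b) (ϕ := ε) (v := a) hε ha
  exact (SmoothVB.smoothAt_trivialLine_iff.1 h).2

lemma contMDiff_homogenize (s : Sec E L) :
    ContMDiff (slitModel E) 𝓘(ℝ, ℝ) ∞ (homogenize s) := fun _ =>
  contMDiffAt_pairing (contMDiffAt_slitDual_iff.1 contMDiffAt_id)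
    (SmoothVB.smoothAt_section (A := lineVB E L) s (proj E L).contMDiff.contMDiffAt)

lemma mdifferentiableAt_homogenize (s : Sec E L) (ε : slitDual L) :
    MDifferentiableAt (slitModel E) 𝓘(ℝ, ℝ) (homogenize s) ε :=
  (contMDiff_homogenize s).mdifferentiable (by simp) ε

/-- The coordinate of a covector with respect to the preferred local frame of `L` around `i`. -/
def fibreCoord (E : Type) [NormedAddCommGroup E] [NormedSpace ℝ E] [ChartedSpace E M]
    [ContMDiffVectorBundle ∞ ℝ L 𝓘(ℝ, E)] (i : M) (ε : slitDual L) : ℝ :=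
  ε.1.2 ((lineVB E L).frame i (1 : ℝ) ε.1.1)

/-- Rank one: `a` is its coordinate times the frame vector. Applied to the values of a section, this
is the local formula `t · (f ∘ p)` for its homogenization. -/
lemma apply_eq_fibreCoord_mul {i : M} {ε : slitDual L} (hε : ε.1.1 ∈ (lineVB E L).dom i)
    (a : L ε.1.1) : ε.1.2 a = fibreCoord E i ε * (show ℝ from (lineVB E L).coord i a) := by
  have h := (lineVB E L).frame_coord hε a
  rw [← SmoothVB.coordCLE_symm_apply (hy := hε)] at h
  have h2 : ((lineVB E L).coordCLE hε).symm ((lineVB E L).coord i a) =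
      (show ℝ from (lineVB E L).coord i a) •
        ((lineVB E L).coordCLE hε).symm (show (lineVB E L).F from (1 : ℝ)) := by
    rw [← ContinuousLinearEquiv.map_smul]
    congr 1
    exact (mul_one (show ℝ from (lineVB E L).coord i a)).symm
  rw [SmoothVB.coordCLE_symm_apply (w := (show (lineVB E L).F from (1 : ℝ)))] at h2
  have h3 := congrArg ε.1.2 (h.symm.trans h2)
  refine h3.trans ((ε.1.2.map_smul _ _).trans ?_)
  exact mul_comm _ _

/-- A covector on a line that kills the frame vector is zero, and the zero section has been removed.
-/
lemma fibreCoord_ne_zero {i : M} {ε : slitDual L} (hε : ε.1.1 ∈ (lineVB E L).dom i) :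
    fibreCoord E i ε ≠ 0 := fun h => ε.2 <| ContinuousLinearMap.ext fun a => by
  rw [apply_eq_fibreCoord_mul hε, h, zero_mul]
  rfl

lemma contMDiffAt_fibreCoord (ε : slitDual L) :
    ContMDiffAt (slitModel E) 𝓘(ℝ, ℝ) ∞ (fibreCoord E ε.1.1 : slitDual L → ℝ) ε :=
  contMDiffAt_pairing (contMDiffAt_slitDual_iff.1 contMDiffAt_id)
    (SmoothVB.smoothAt_frame (lineVB E L) (b := fun η : slitDual L => η.1.1)
      (proj E L).contMDiff.contMDiffAt _)

lemma pairing_bijective (ε : slitDual L) :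
    Function.Bijective (fun a : L (proj E L ε) => (ε.1.2 a : ℝ)) := by
  have hε := (lineVB E L).mem_dom ε.1.1
  constructor
  · refine (injective_iff_map_eq_zero ε.1.2).2 fun a ha => ?_
    rw [apply_eq_fibreCoord_mul (E := E) hε] at ha
    have h0 := (mul_eq_zero.1 ha).resolve_left (fibreCoord_ne_zero hε)
    exact ((lineVB E L).coordCLE hε).map_eq_zero_iff.1 h0
  · intro c
    refine ⟨(c / fibreCoord E ε.1.1 ε) • (lineVB E L).frame ε.1.1 (1 : ℝ) ε.1.1, ?_⟩
    refine (ε.1.2.map_smul _ _).trans ?_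
    exact div_mul_cancel₀ c (fibreCoord_ne_zero hε)

instance : FiniteDimensional ℝ (lineVB E L).F := inferInstanceAs (FiniteDimensional ℝ ℝ)

instance {E H : Type} [NormedAddCommGroup E] [NormedSpace ℝ E] [TopologicalSpace H]
    {I : ModelWithCorners ℝ E H} {B : Type u} [TopologicalSpace B] [ChartedSpace H B] :
    FiniteDimensional ℝ (SmoothVB.trivialLine I B).F := inferInstanceAs (FiniteDimensional ℝ ℝ)

instance {E H : Type} [NormedAddCommGroup E] [NormedSpace ℝ E] [TopologicalSpace H]
    {I : ModelWithCorners ℝ E H} {B : Type u} [TopologicalSpace B] [ChartedSpace H B]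
    {E' H' : Type} [NormedAddCommGroup E'] [NormedSpace ℝ E'] [TopologicalSpace H']
    {I' : ModelWithCorners ℝ E' H'} {B' : Type w} [TopologicalSpace B'] [ChartedSpace H' B']
    {f : ContMDiffMap I' I B' B ∞} {A : SmoothVB.{u, v} I B} [FiniteDimensional ℝ A.F] :
    FiniteDimensional ℝ (A.pullback f).F := inferInstanceAs (FiniteDimensional ℝ A.F)

instance {E H : Type} [NormedAddCommGroup E] [NormedSpace ℝ E] [TopologicalSpace H]
    {I : ModelWithCorners ℝ E H} {B : Type u} [TopologicalSpace B] [ChartedSpace H B]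
    {A C : SmoothVB.{u, v} I B} [FiniteDimensional ℝ A.F] [FiniteDimensional ℝ C.F] :
    FiniteDimensional ℝ (A.hom C).F := inferInstanceAs (FiniteDimensional ℝ (A.F →L[ℝ] C.F))

/-- The pairing with `ε`, as a linear isomorphism from the fibre of `L`. -/
def pairingEquiv (ε : slitDual L) : L (proj E L ε) ≃ₗ[ℝ] ℝ :=
  LinearEquiv.ofBijective ((ε.1.2 : L ε.1.1 →L[ℝ] ℝ) : L ε.1.1 →ₗ[ℝ] ℝ) 
    (pairing_bijective (E := E) ε)

variable (E L) in
/-- The pull-back of `L` to `L* ∖ 0` is trivialized by the tautological pairing. -/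
def lineIso : ((lineVB E L).pullback (proj E L)).Iso
    (SmoothVB.trivialLine (slitModel E) (slitDual L)) :=
  SmoothVB.Iso.ofLinearEquiv (A := (lineVB E L).pullback (proj E L))
    (C := SmoothVB.trivialLine (slitModel E) (slitDual L))
    (fun ε => pairingEquiv (E := E) ε) fun _ w =>
      SmoothVB.smoothAt_trivialLine_iff.2 ⟨contMDiffAt_id, contMDiffAt_pairing
        (contMDiffAt_slitDual_iff.1 contMDiffAt_id) (SmoothVB.smoothAt_pullback_iff.1
          (SmoothVB.smoothAt_frame ((lineVB E L).pullback (proj E L)) contMDiffAt_id w)).2⟩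

/-- Multiplication by a non-vanishing function. -/
lemma contMDiffAt_smul_slitDual {c : X → ℝ} (h0 : ∀ x, c x ≠ 0) {e : X → slitDual L}
    (hc : ContMDiffAt IX 𝓘(ℝ, ℝ) ∞ c x₀) (he : ContMDiffAt IX (slitModel E) ∞ e x₀) :
    ContMDiffAt IX (slitModel E) ∞
      (fun x => (⟨⟨(e x).1.1, c x • (e x).1.2⟩, smul_ne_zero (h0 x) (e x).2⟩ : slitDual L)) x₀ :=
  contMDiffAt_slitDual_iff.2
    (SmoothVB.SmoothAt.smul (A := dualVB E L) hc (contMDiffAt_slitDual_iff.1 he))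

variable (E) in
lemma contMDiff_scale (r : ℝˣ) :
    ContMDiff (slitModel E) (slitModel E) ∞ (scale r : slitDual L → slitDual L) := fun _ =>
  contMDiffAt_smul_slitDual (fun _ => r.ne_zero) contMDiffAt_const contMDiffAt_id

variable (E) in
/-- Local sections of `L* ∖ 0` through a given point. -/
lemma exists_localSection (ε : slitDual L) : ∃ σ : M → slitDual L, σ (proj E L ε) = ε ∧
    ContMDiffAt 𝓘(ℝ, E) (slitModel E) ∞ σ (proj E L ε) ∧
    ∀ᶠ y in 𝓝 (proj E L ε), proj E L (σ y) = y := by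
  classical
  let D := dualVB E L
  -- The section extends `ε` with constant coordinate `c`, which is non-zero, so it avoids the zero
  -- section on the trivializing domain.
  let c : D.F := D.coord ε.1.1 (y := ε.1.1) ε.1.2
  let ζ : ∀ y, Dual L y := D.frame ε.1.1 c
  have hζ : ζ ε.1.1 = ε.1.2 := D.frame_coord (D.mem_dom ε.1.1) _
  have h0 : ∀ y ∈ D.dom ε.1.1, ζ y ≠ 0 := fun y hy h => by
    have h1 : (D.coordCLE hy).symm c = 0 := (D.coordCLE_symm_apply hy c).trans h
    have h2 : c = 0 := (D.coordCLE hy).symm.map_eq_zero_iff.1 h1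
    exact ε.2 ((D.coordCLE (D.mem_dom ε.1.1)).map_eq_zero_iff.1 h2)
  -- The value `ε` away from the domain is arbitrary; only the germ of `σ` at the base point
  -- matters.
  let σ : M → slitDual L := fun y => if h : ζ y ≠ 0 then ⟨⟨y, ζ y⟩, h⟩ else ε
  have hσ : ∀ᶠ y in 𝓝 ε.1.1, (σ y).1 = ⟨y, ζ y⟩ := by
    filter_upwards [D.dom_mem_nhds ε.1.1] with y hy
    simp only [σ, dif_pos (h0 y hy)]
  refine ⟨σ, ?_, ?_, hσ.mono fun y hy => ?_⟩
  · refine Subtype.ext (hσ.self_of_nhds.trans ?_)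
    change (⟨ε.1.1, ζ ε.1.1⟩ : DualTotal L) = _
    rw [hζ]
  · refine (ContMDiffAt.subtypeVal_comp_iff (slitDual L) σ _).1 ?_
    refine ContMDiffAt.congr_of_eventuallyEq ?_ hσ
    exact SmoothVB.smoothAt_frame D (b := fun y => y) contMDiffAt_id c
  · change (σ y).1.1 = y
    rw [hy]

/-- Differentiating `p ∘ σ = id` for a local section `σ` through `ε` exhibits a right inverse of
`dp`. -/
lemma mfderiv_proj_surjective (ε : slitDual L) :
    Function.Surjective (mfderiv (slitModel E) 𝓘(ℝ, E) (proj E L) ε) := by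
  obtain ⟨σ, h1, h2, h3⟩ := exists_localSection E ε
  have hp : MDifferentiableAt (slitModel E) 𝓘(ℝ, E) (proj E L) (σ (proj E L ε)) :=
    (proj E L).contMDiff.mdifferentiable (by simp) _
  have h4 := mfderiv_comp (proj E L ε) hp (h2.mdifferentiableAt (by simp))
  have h5 : (proj E L ∘ σ) =ᶠ[𝓝 (proj E L ε)] id := h3
  rw [h5.mfderiv_eq, mfderiv_id] at h4
  have h6 : Function.Surjective (mfderiv (slitModel E) 𝓘(ℝ, E) (proj E L) (σ (proj E L ε))) :=
    fun v => ⟨_, (DFunLike.congr_fun h4 v).symm⟩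
  -- The point `σ (p ε)` equals `ε` only propositionally and the tangent spaces depend on it, so the
  -- equality is eliminated for a general `η`.
  have h7 : ∀ η, η = ε → Function.Surjective (mfderiv (slitModel E) 𝓘(ℝ, E) (proj E L) η) →
      Function.Surjective (mfderiv (slitModel E) 𝓘(ℝ, E) (proj E L) ε) := by
    rintro _ rfl h
    exact h
  exact h7 _ h1 h6

/-- Product and chain rule for the local formula `t · (f ∘ p)`, where `t` is `fibreCoord` and `f` is
`loc` around the base point. -/
lemma mfderiv_homogenize (s : Sec E L) (ε : slitDual L) (v : TangentSpace (slitModel E) ε) :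
    mfderiv (slitModel E) 𝓘(ℝ, ℝ) (homogenize s) ε v =
      (fibreCoord E ε.1.1 ε * (show ℝ from mfderiv 𝓘(ℝ, E) 𝓘(ℝ, ℝ) (loc ε.1.1 s) ε.1.1
        (mfderiv (slitModel E) 𝓘(ℝ, E) (proj E L) ε v)) +
      loc ε.1.1 s ε.1.1 * (show ℝ from
        mfderiv (slitModel E) 𝓘(ℝ, ℝ) (fibreCoord E ε.1.1 : slitDual L → ℝ) ε v) : ℝ) := by
  have hp := (proj E L).contMDiff.mdifferentiable (by simp) ε
  have hl := mdifferentiableAt_loc (mem_base (E := E) (L := L) ε.1.1) s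
  have ht := (contMDiffAt_fibreCoord (E := E) ε).mdifferentiableAt (by simp)
  have h1 : homogenize s =ᶠ[𝓝 ε] fibreCoord E ε.1.1 * (loc ε.1.1 s ∘ proj E L) := by
    have h2 := (proj E L).contMDiff.continuous.continuousAt.eventually
      ((lineVB E L).dom_mem_nhds ε.1.1)
    filter_upwards [h2] with η hη
    exact apply_eq_fibreCoord_mul hη (s η.1.1)
  have h3 := (ht.hasMFDerivAt.mul (HasMFDerivAt.comp ε
    (show HasMFDerivAt 𝓘(ℝ, E) 𝓘(ℝ, ℝ) (loc ε.1.1 s) (proj E L ε) _ from hl.hasMFDerivAt)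
    hp.hasMFDerivAt)).mfderiv
  rw [h1.mfderiv_eq, h3]
  rfl

end SlitDual

/-! ### Jets of sections and covectors on the slit dual -/

section Jets

variable {E : Type} [NormedAddCommGroup E] [NormedSpace ℝ E]
  {M : Type u} [TopologicalSpace M] [ChartedSpace E M]
  {L : M → Type u} [TopologicalSpace (TotalSpace ℝ L)] [∀ x, AddCommGroup (L x)]
  [∀ x, Module ℝ (L x)] [∀ x, TopologicalSpace (L x)] [FiberBundle ℝ L] [VectorBundle ℝ ℝ L]
  [ContMDiffVectorBundle ∞ ℝ L 𝓘(ℝ, E)]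

lemma homogenize_add (s t : Sec E L) : homogenize (s + t) = homogenize s + homogenize t :=
  funext fun ε => ε.1.2.map_add _ _

lemma homogenize_smul (c : ℝ) (s : Sec E L) : homogenize (c • s) = c • homogenize s :=
  funext fun ε => ε.1.2.map_smul _ _

/-- The differential at `ε` of the homogenization, as a linear function of the section. -/
def homogenizeDiff (ε : slitDual L) : Sec E L →ₗ[ℝ] (TangentSpace (slitModel E) ε →L[ℝ] ℝ) where
  toFun s := mfderiv (slitModel E) 𝓘(ℝ, ℝ) (homogenize s) ε
  map_add' s t := by
    rw [homogenize_add]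
    exact mfderiv_add (mdifferentiableAt_homogenize s ε) (mdifferentiableAt_homogenize t ε)
  map_smul' c s := by
    rw [homogenize_smul]
    exact const_smul_mfderiv (mdifferentiableAt_homogenize s ε) c

lemma loc_eq_zero_iff {x : M} {s : Sec E L} : loc x s x = 0 ↔ s x = 0 :=
  ((trivializationAt ℝ L x).continuousLinearEquivAt ℝ x
    (mem_base (E := E) x).2).map_eq_zero_iff (x := s x)

/-- Both terms of `mfderiv_homogenize` carry a factor that vanishes. This makes `jetDiff` well
defined on jets. -/
lemma homogenizeDiff_of_mem_vanishing (ε : slitDual L) {s : Sec E L}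
    (hs : s ∈ vanishing E L (proj E L ε)) : homogenizeDiff ε s = 0 := by
  obtain ⟨h0, h1⟩ := hs
  have h0' : loc ε.1.1 s ε.1.1 = 0 := loc_eq_zero_iff.2 h0
  have h1' : mfderiv 𝓘(ℝ, E) 𝓘(ℝ, ℝ) (loc ε.1.1 s) ε.1.1 = 0 := h1
  ext v
  refine (mfderiv_homogenize s ε v).trans ?_
  rw [h0', h1', zero_mul, add_zero]
  exact mul_zero (fibreCoord E ε.1.1 ε)

/-- The Euler field on `L* ∖ 0` recovers the homogenization of a section from its differential. -/
lemma homogenize_eq_zero_of_diff {ε : slitDual L} {s : Sec E L} (h : homogenizeDiff ε s = 0) :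
    homogenize s ε = 0 := by
  -- `γ` is the integral curve of the Euler field through `ε`. Along it the homogenization is `exp
  -- r` times its value at `ε`, so its derivative at `0` is that value.
  let γ : ℝ → slitDual L := fun r =>
    ⟨⟨ε.1.1, Real.exp r • ε.1.2⟩, smul_ne_zero (Real.exp_ne_zero r) ε.2⟩
  have hγ : ContMDiffAt 𝓘(ℝ, ℝ) (slitModel E) ∞ γ 0 :=
    contMDiffAt_smul_slitDual Real.exp_ne_zero Real.contDiff_exp.contMDiff.contMDiffAt
      (contMDiffAt_const (c := ε))
  have h0 : γ 0 = ε := Subtype.ext (by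
    change (⟨ε.1.1, Real.exp 0 • ε.1.2⟩ : DualTotal L) = ε.1
    rw [Real.exp_zero, one_smul])
  have h1 : ∀ η, η = ε → mfderiv (slitModel E) 𝓘(ℝ, ℝ) (homogenize s) η = 0 := by
    rintro _ rfl
    exact h
  have h2 := mfderiv_comp (0 : ℝ) (mdifferentiableAt_homogenize s (γ 0))
    (hγ.mdifferentiableAt (by simp))
  have h3 : homogenize s ∘ γ = fun r => Real.exp r * homogenize s ε := funext fun r => rfl
  rw [h1 _ h0, h3, _root_.mfderiv_eq_fderiv] at h2
  have h4 : HasDerivAt (fun r => Real.exp r * homogenize s ε) (Real.exp 0 * homogenize s ε) 0 :=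
    (Real.hasDerivAt_exp 0).mul_const _
  have h5 := h4.deriv
  rw [← fderiv_apply_one_eq_deriv, Real.exp_zero, one_mul] at h5
  rw [← h5]
  exact DFunLike.congr_fun h2 (1 : ℝ)

/-- The Euler field gives the vanishing of the value. The term with `dt` then drops out, and since
`t ≠ 0` and `dp` is surjective, the derivative vanishes too. This is the injectivity of `jetDiff`.
-/
lemma mem_vanishing_of_diff {ε : slitDual L} {s : Sec E L} (h : homogenizeDiff ε s = 0) :
    s ∈ vanishing E L (proj E L ε) := by
  have h0 : s (proj E L ε) = 0 := (pairing_bijective (E := E) ε).1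
    ((homogenize_eq_zero_of_diff h).trans (ε.1.2.map_zero).symm)
  refine ⟨h0, ?_⟩
  ext w
  obtain ⟨v, rfl⟩ := mfderiv_proj_surjective ε w
  have h1 := (mfderiv_homogenize s ε v).symm.trans (DFunLike.congr_fun h v)
  have h0' : loc ε.1.1 s ε.1.1 = 0 := loc_eq_zero_iff.2 h0
  rw [h0', zero_mul, add_zero] at h1
  exact (mul_eq_zero.1 h1).resolve_left (fibreCoord_ne_zero ((lineVB E L).mem_dom ε.1.1))

variable [IsManifold 𝓘(ℝ, E) ∞ M]

instance [FiniteDimensional ℝ E] :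
    FiniteDimensional ℝ (SmoothVB.tangent (slitModel E) (slitDual L)).F :=
  inferInstanceAs (FiniteDimensional ℝ (E × (ℝ →L[ℝ] ℝ)))

instance [FiniteDimensional ℝ E] :
    FiniteDimensional ℝ (SmoothVB.cotangent (slitModel E) (slitDual L)).F :=
  inferInstanceAs (FiniteDimensional ℝ ((E × (ℝ →L[ℝ] ℝ)) →L[ℝ] ℝ))

lemma smoothAt_homogenizeDiff [FiniteDimensional ℝ E] (s : Sec E L) (ε : slitDual L) :
    (SmoothVB.cotangent (slitModel E) (slitDual L)).SmoothAt (slitModel E) (b := fun η => η)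
      (fun η => homogenizeDiff η s) ε := by
  refine SmoothVB.smoothAt_hom_of_frame contMDiffAt_id fun w =>
    SmoothVB.smoothAt_trivialLine_iff.2 ⟨contMDiffAt_id, ?_⟩
  have h1 := SmoothVB.smoothAt_frame (SmoothVB.tangent (slitModel E) (slitDual L))
    (b := fun η => η) (x₀ := ε) contMDiffAt_id w
  -- The differential on a frame vector is the second component of the tangent map of the
  -- homogenization.
  have h2 := (contMDiff_homogenize s).contMDiff_tangentMap (m := ∞) (by simp)
  have h3 := (contMDiff_snd_tangentBundle_modelSpace ℝ 𝓘(ℝ, ℝ) (n := ∞)).comp h2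
  exact h3.contMDiffAt.comp ε h1

variable [FiniteDimensional ℝ E] [T2Space M]

/-- The fibre at `x` is modelled by the coordinates around `x` itself; the trivialization around `i`
then applies the change of coordinates from `x` to `i`. -/
lemma jetBundle_coord {i x : M} (hx : x ∈ base E L i) (s : Sec E L) :
    (jetBundle E L).coord i (jet x s) = jetC i x s :=
  jetChange_jetC (mem_base x) hx s

/-- Sections with affine local representative. -/
lemma exists_affine_section (i : M) (b : ℝ) (α : E →L[ℝ] ℝ) : ∃ s : Sec E L, ∀ᶠ x in 𝓝 i,
    jetC i x s = (b + α (chartAt E i x - chartAt E i i), α) := by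
  obtain ⟨χ, h1, hχ⟩ := exists_bump (E := E) (isOpen_base (E := E) (L := L) i) (mem_base i)
  have hh : ContMDiffOn 𝓘(ℝ, E) 𝓘(ℝ, ℝ) ∞ (fun y => b + α (chartAt E i y - chartAt E i i))
      (base E L i) := by
    refine contMDiffOn_const.add (contMDiffOn_const.clm_apply
      (ContMDiffOn.sub ?_ contMDiffOn_const))
    exact (contMDiffOn_chart (I := 𝓘(ℝ, E)) (x := i)).mono inter_subset_left
  refine ⟨cutSec i χ hχ _ hh, ?_⟩
  -- The derivative at `x` requires the cut-off to be `1` near `x`, not merely at `x`.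
  filter_upwards [(isOpen_base (E := E) (L := L) i).mem_nhds (mem_base i),
    h1.eventually_nhds] with x hx hx1
  refine Prod.ext ?_ ?_
  · simp [jetC, loc_cutSec hx, hx1.self_of_nhds]
  · have e : loc i (cutSec i χ hχ _ hh) ∘ (chartAt E i).symm =ᶠ[𝓝 (chartAt E i x)]
        fun z => b + α (z - chartAt E i i) := by
      have := eventually_symm hx.1 (p := fun y => loc i (cutSec i χ hχ _ hh) y =
          b + α (chartAt E i y - chartAt E i i)) <| by
        filter_upwards [(isOpen_base (E := E) (L := L) i).mem_nhds hx, hx1] with y hy hy1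
        rw [loc_cutSec hy, hy1, one_mul]
      filter_upwards [this, (chartAt E i).open_target.mem_nhds
        ((chartAt E i).map_source hx.1)] with z hz hz'
      rw [Function.comp_apply, hz, (chartAt E i).right_inv hz']
    refine e.fderiv_eq.trans ?_
    rw [fderiv_const_add]
    have : HasFDerivAt (fun z => α (z - chartAt E i i)) (α.comp (.id ℝ E)) (chartAt E i x) :=
      α.hasFDerivAt.comp _ ((hasFDerivAt_id _).sub_const _)
    simpa using this.fderiv

/-- The constant-coordinate frame is in general not the jet of one section: a section of constant
slope `α` has a varying value. A multiple of the jet of `t`, with coordinates `(1, 0)`, corrects the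
value without changing the slope. -/
lemma exists_jet_frame (i : M) (b : ℝ) (α : E →L[ℝ] ℝ) : ∃ s t : Sec E L, ∀ᶠ x in 𝓝 i,
    (jetBundle E L).frame i (b, α) x =
      jet x s + (b - α (chartAt E i x - chartAt E i i)) • jet x t := by
  obtain ⟨s, hs⟩ := exists_affine_section (L := L) i 0 α
  obtain ⟨t, ht⟩ := exists_affine_section (L := L) i 1 (0 : E →L[ℝ] ℝ)
  refine ⟨s, t, ?_⟩
  filter_upwards [hs, ht, (jetBundle E L).dom_mem_nhds i] with x hsx htx hx
  refine ((jetBundle E L).coordCLE hx).injective ?_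
  refine ((jetBundle E L).coord_frame hx (b, α)).trans ?_
  refine Eq.symm (((jetBundle E L).coord_add hx _ _).trans ?_)
  refine (congrArg _ ((jetBundle E L).coord_smul hx _ _)).trans ?_
  refine (congrArg₂ (fun p q : ℝ × (E →L[ℝ] ℝ) =>
    p + (b - α (chartAt E i x - chartAt E i i)) • q) ((jetBundle_coord (i := i) hx s).trans hsx)
    ((jetBundle_coord (i := i) hx t).trans htx)).trans ?_
  exact Prod.ext (by simp) (by simp)

/-- The differential at `ε` of the homogenization, as a function of the `1`-jet of the section. -/
def jetDiff (ε : slitDual L) :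
    Jet E L (proj E L ε) →ₗ[ℝ] (TangentSpace (slitModel E) ε →L[ℝ] ℝ) :=
  (vanishing E L (proj E L ε)).liftQ (homogenizeDiff ε) fun _ hs =>
    homogenizeDiff_of_mem_vanishing ε hs

lemma jetDiff_jet (ε : slitDual L) (s : Sec E L) :
    jetDiff ε (jet (proj E L ε) s) = homogenizeDiff ε s := rfl

lemma jetDiff_injective (ε : slitDual L) : Function.Injective (jetDiff (E := E) ε) := by
  refine (injective_iff_map_eq_zero _).2 fun j hj => ?_
  obtain ⟨s, rfl⟩ := (vanishing E L (proj E L ε)).mkQ_surjective j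
  exact (Submodule.Quotient.mk_eq_zero _).2 (mem_vanishing_of_diff hj)

/-- `1`-jets at the base point of `ε` are the same as covectors at `ε`. -/
def jetDiffEquiv (ε : slitDual L) :
    Jet E L (proj E L ε) ≃ₗ[ℝ] (TangentSpace (slitModel E) ε →L[ℝ] ℝ) := by
  refine LinearEquiv.ofBijective (jetDiff ε) ⟨jetDiff_injective ε, ?_⟩
  let e₁ : Jet E L (proj E L ε) ≃ₗ[ℝ] ℝ × (E →L[ℝ] ℝ) := jetEquiv E L (proj E L ε)
  have : FiniteDimensional ℝ (Jet E L (proj E L ε)) := e₁.symm.finiteDimensional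
  have : FiniteDimensional ℝ (TangentSpace (slitModel E) ε →L[ℝ] ℝ) :=
    inferInstanceAs (FiniteDimensional ℝ ((E × (ℝ →L[ℝ] ℝ)) →L[ℝ] ℝ))
  have hdual : ∀ (F : Type) [NormedAddCommGroup F] [NormedSpace ℝ F] [FiniteDimensional ℝ F],
      Module.finrank ℝ (F →L[ℝ] ℝ) = Module.finrank ℝ F := fun F _ _ _ =>
    (LinearMap.toContinuousLinearMap (𝕜 := ℝ) (E := F) (F' := ℝ)).finrank_eq.symm.trans
      Subspace.dual_finrank_eq
  -- Both dimensions are `dim E + 1`, so injectivity suffices.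
  have h : Module.finrank ℝ (Jet E L (proj E L ε)) =
      Module.finrank ℝ (TangentSpace (slitModel E) ε →L[ℝ] ℝ) := by
    refine e₁.finrank_eq.trans (Eq.trans ?_ (hdual (E × (ℝ →L[ℝ] ℝ))).symm)
    rw [Module.finrank_prod, Module.finrank_prod, hdual, hdual, add_comm]
  exact (LinearMap.injective_iff_surjective_of_finrank_eq_finrank h).1 (jetDiff_injective ε)

variable (E L) in
/-- The pull-back of `J¹L` to `L* ∖ 0` is the cotangent bundle. -/
def jetIso : ((jetBundle E L).pullback (proj E L)).Iso
    (SmoothVB.cotangent (slitModel E) (slitDual L)) :=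
  SmoothVB.Iso.ofLinearEquiv (A := (jetBundle E L).pullback (proj E L))
    (C := SmoothVB.cotangent (slitModel E) (slitDual L)) (fun ε => jetDiffEquiv ε) fun ε w => by
      obtain ⟨b, α⟩ : ℝ × (E →L[ℝ] ℝ) := w
      obtain ⟨s, t, h⟩ := exists_jet_frame (L := L) (proj E L ε) b α
      -- The frame goes to the differential of one homogenization plus this coefficient times that
      -- of another.
      have hc : ContMDiffAt (slitModel E) 𝓘(ℝ, ℝ) ∞ (fun η : slitDual L =>
          b - α (chartAt E (proj E L ε) (proj E L η) - chartAt E (proj E L ε) (proj E L ε))) ε :=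
        contMDiffAt_const.sub (contMDiffAt_const.clm_apply
          (ContMDiffAt.sub (((contMDiffOn_chart (I := 𝓘(ℝ, E)) (x := proj E L ε)).contMDiffAt
            ((chartAt E (proj E L ε)).open_source.mem_nhds (mem_chart_source E _))).comp ε
              (proj E L).contMDiff.contMDiffAt) contMDiffAt_const))
      refine ((smoothAt_homogenizeDiff s ε).add
        (.smul hc (smoothAt_homogenizeDiff t ε))).congr ?_
      filter_upwards [(proj E L).contMDiff.continuous.continuousAt.eventually h,
        (proj E L).contMDiff.continuous.continuousAt.eventually
          ((jetBundle E L).dom_mem_nhds (proj E L ε))] with η hη hη'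
      refine (congrArg (jetDiff η)
        (((jetBundle E L).frame_pullback hη' (b, α)).trans hη)).trans ?_
      rw [map_add, map_smul, jetDiff_jet, jetDiff_jet]
      rfl

end Jets

end LineBundle

namespace SmoothVB

/-! ### The bidual of a bundle of finite rank -/

section Bidual

variable {E H : Type} [NormedAddCommGroup E] [NormedSpace ℝ E] [TopologicalSpace H]
  {I : ModelWithCorners ℝ E H} {B : Type u} [TopologicalSpace B] [ChartedSpace H B]

/-- Evaluation of covectors at a vector. -/
def evalAt (A : SmoothVB.{u, 0} I B) [FiniteDimensional ℝ A.F] (x : B) :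
    A.V x →ₗ[ℝ] ((A.V x →L[ℝ] ℝ) →L[ℝ] ℝ) where
  toFun a :=
    { toFun := fun θ => θ a
      map_add' := fun _ _ => rfl
      map_smul' := fun _ _ => rfl
      cont := continuous_of_fibre (A.hom (trivialLine I B)) (x := x) (W := ℝ)
        { toFun := fun θ : A.V x →L[ℝ] ℝ => θ a
          map_add' := fun _ _ => rfl
          map_smul' := fun _ _ => rfl } }
  map_add' a a' := ContinuousLinearMap.ext fun θ => θ.map_add a a'
  map_smul' c a := ContinuousLinearMap.ext fun θ => θ.map_smul c a

/-- Reflexivity of the finite-dimensional model fibre, carried to the fibre by a trivialization. -/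
lemma evalAt_bijective (A : SmoothVB.{u, 0} I B) [FiniteDimensional ℝ A.F] (x : B) :
    Function.Bijective (A.evalAt x) := by
  let e : A.V x ≃L[ℝ] A.F := A.coordCLE (A.mem_dom x)
  constructor
  · refine (injective_iff_map_eq_zero _).2 fun a ha => e.map_eq_zero_iff.1 ?_
    by_contra h
    obtain ⟨θ, hθ⟩ := SeparatingDual.exists_ne_zero (R := ℝ) h
    exact hθ (DFunLike.congr_fun ha (θ.comp (e : A.V x →L[ℝ] A.F)))
  · intro ξ
    obtain ⟨v, hv⟩ := exists_vector A.F
      { toFun := fun θ : A.F →L[ℝ] ℝ => ξ (θ.comp (e : A.V x →L[ℝ] A.F))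
        map_add' := fun θ θ' => by rw [ContinuousLinearMap.add_comp, map_add]
        map_smul' := fun c θ => by rw [ContinuousLinearMap.smul_comp, map_smul]; rfl }
    refine ⟨e.symm v, ContinuousLinearMap.ext fun θ => ?_⟩
    refine (hv (θ.comp (e.symm : A.F →L[ℝ] A.V x))).symm.trans (congrArg ξ ?_)
    ext a
    exact congrArg θ (e.symm_apply_apply a)

/-- The isomorphism of a vector bundle of finite rank with its bidual. -/
def bidualIso (A : SmoothVB.{u, 0} I B) [FiniteDimensional ℝ A.F] :
    Iso A ((A.hom (trivialLine I B)).hom (trivialLine I B)) :=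
  Iso.ofLinearEquiv (C := (A.hom (trivialLine I B)).hom (trivialLine I B))
    (fun x => LinearEquiv.ofBijective (A.evalAt x) (A.evalAt_bijective x)) fun _ w =>
      smoothAt_hom_of_frame (A := A.hom (trivialLine I B)) contMDiffAt_id fun w' =>
        (smoothAt_frame (A.hom (trivialLine I B)) (b := fun x => x) contMDiffAt_id w').apply
          (smoothAt_frame A (b := fun x => x) contMDiffAt_id w)

end Bidual

end SmoothVB

namespace LineBundle

/-! ### The isomorphisms for covectors, vectors and tensors -/

section Isomorphisms

variable (E : Type) [NormedAddCommGroup E] [NormedSpace ℝ E] [FiniteDimensional ℝ E]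
  {M : Type u} [TopologicalSpace M] [T2Space M] [ChartedSpace E M] [IsManifold 𝓘(ℝ, E) ∞ M]
  (L : M → Type u) [TopologicalSpace (TotalSpace ℝ L)] [∀ x, AddCommGroup (L x)]
  [∀ x, Module ℝ (L x)] [∀ x, TopologicalSpace (L x)] [FiberBundle ℝ L] [VectorBundle ℝ ℝ L]
  [ContMDiffVectorBundle ∞ ℝ L 𝓘(ℝ, E)]

/-- Derivations of `L` are linear maps from `1`-jets to `L`. -/
def derIso : (derBundle E L).Iso ((jetBundle E L).hom (lineVB E L)) :=
  SmoothVB.transportIso _ _ _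

/-- Covectors on `L* ∖ 0` are `1`-jets of sections of `L`. -/
def cotangentIso : (SmoothVB.cotangent (slitModel E) (slitDual L)).Iso
    ((jetBundle E L).pullback (proj E L)) := (jetIso E L).symm

/-- Vectors on `L* ∖ 0` are derivations of `L`. -/
def tangentIso : (SmoothVB.tangent (slitModel E) (slitDual L)).Iso
    ((derBundle E L).pullback (proj E L)) :=
  -- `T ≅ Hom(T*, ℝ) ≅ p*Hom(J¹L, L) ≅ p*DL`, the middle step being conjugation by the covector
  -- isomorphism and the pairing.
  (SmoothVB.bidualIso (SmoothVB.tangent (slitModel E) (slitDual L))).trans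
    (((cotangentIso E L).homPullback (lineIso E L).symm).trans
      ((derIso E L).symm.pullback (proj E L)))

variable {E L}

instance : FiniteDimensional ℝ (derBundle E L).F :=
  inferInstanceAs (FiniteDimensional ℝ ((ℝ × (E →L[ℝ] ℝ)) →L[ℝ] ℝ))

lemma pairing_lineIso_symm (ε : slitDual L) (c : ℝ) :
    ε.1.2 (((lineIso E L).toFun ε).symm c) = c :=
  ((lineIso E L).toFun ε).apply_symm_apply c

lemma cotangentIso_mfderiv (ε : slitDual L) (s : Sec E L) :
    (cotangentIso E L).toFun ε (mfderiv (slitModel E) 𝓘(ℝ, ℝ) (homogenize s) ε) =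
      jet (proj E L ε) s :=
  ((jetIso E L).toFun ε).symm_apply_apply (jet (proj E L ε) s)

/-- By construction the derivation sends `s` to the element of the line whose pairing with `ε` is
the covector of its jet evaluated at `v`. -/
lemma pairing_tangentIso (ε : slitDual L) (v : TangentSpace (slitModel E) ε) (s : Sec E L) :
    ε.1.2 (derApply (x := proj E L ε) ((tangentIso E L).toFun ε v) s) =
      mfderiv (slitModel E) 𝓘(ℝ, ℝ) (homogenize s) ε v :=
  pairing_lineIso_symm (E := E) ε _

variable (E L) in
/-- Tensors on `L* ∖ 0` are Atiyah tensors on `L`. -/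
def tensorIso (l m : ℕ) : (tensors E L l m).Iso ((atiyah E L l m).pullback (proj E L)) :=
  (tangentIso E L).multiPullback ((cotangentIso E L).multiPullback (lineIso E L).symm m) l

lemma pairing_tensorIso {l m : ℕ} (ε : slitDual L) (T : (tensors E L l m).V ε)
    (v : Fin l → TangentSpace (slitModel E) ε)
    (θ : Fin m → (TangentSpace (slitModel E) ε →L[ℝ] ℝ)) :
    ε.1.2 (atiyahEval E L l m (x := proj E L ε) ((tensorIso E L l m).toFun ε T)
      (fun i => (tangentIso E L).toFun ε (v i)) (fun j => (cotangentIso E L).toFun ε (θ j))) =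
      tensorEval E L l m T v θ := by
  have h1 := (tangentIso E L).eval_multiPullback
    ((cotangentIso E L).multiPullback (lineIso E L).symm m) l T v
  have h2 := (cotangentIso E L).eval_multiPullback (lineIso E L).symm m
    (SmoothVB.eval (SmoothVB.tangent _ _) _ l T v) θ
  refine (congrArg ε.1.2 ((congrArg (fun S => SmoothVB.eval (jetBundle E L) (lineVB E L)
    (x := proj E L ε) m S fun j => (cotangentIso E L).toFun ε (θ j)) h1).trans h2)).trans ?_
  exact pairing_lineIso_symm (E := E) ε _

end Isomorphisms

/-! ### Homogeneity as invariance, and descent to `M` -/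

section Homogeneous

variable {E : Type} [NormedAddCommGroup E] [NormedSpace ℝ E] [FiniteDimensional ℝ E]
  {M : Type u} [TopologicalSpace M] [T2Space M] [ChartedSpace E M] [IsManifold 𝓘(ℝ, E) ∞ M]
  {L : M → Type u} [TopologicalSpace (TotalSpace ℝ L)] [∀ x, AddCommGroup (L x)]
  [∀ x, Module ℝ (L x)] [∀ x, TopologicalSpace (L x)] [FiberBundle ℝ L] [VectorBundle ℝ ℝ L]
  [ContMDiffVectorBundle ∞ ℝ L 𝓘(ℝ, E)]

lemma mfderiv_homogenize_dscale (r : ℝˣ) (ε : slitDual L) (s : Sec E L)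
    (v : TangentSpace (slitModel E) ε) :
    mfderiv (slitModel E) 𝓘(ℝ, ℝ) (homogenize s) (scale r ε) (dscale E L r ε v) =
      ((r : ℝ) * (show ℝ from mfderiv (slitModel E) 𝓘(ℝ, ℝ) (homogenize s) ε v) : ℝ) := by
  have h1 := mfderiv_comp ε (mdifferentiableAt_homogenize s (scale r ε))
    ((contMDiff_scale E r).mdifferentiable (by simp) ε)
  have h2 : homogenize s ∘ scale r = (r : ℝ) • homogenize s := rfl
  rw [h2] at h1
  have h3 := const_smul_mfderiv (mdifferentiableAt_homogenize s ε) (r : ℝ)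
  exact (DFunLike.congr_fun h1 v).symm.trans (DFunLike.congr_fun h3 v)

/-- The factor `r` from differentiating homogenizations along `dh_r` cancels against pairing with
`rε` in place of `ε`. -/
lemma tangentIso_dscale (r : ℝˣ) (ε : slitDual L) (v : TangentSpace (slitModel E) ε) :
    (tangentIso E L).toFun (scale r ε) (dscale E L r ε v) = (tangentIso E L).toFun ε v := by
  refine Subtype.ext (LinearMap.ext fun s => ?_)
  refine (pairing_bijective (E := E) (scale r ε)).1 ?_
  refine (pairing_tangentIso (scale r ε) (dscale E L r ε v) s).trans ?_
  refine (mfderiv_homogenize_dscale r ε s v).trans ?_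
  exact congrArg ((r : ℝ) * ·) (pairing_tangentIso ε v s).symm

lemma cotangentIso_comp_dscale (r : ℝˣ) (ε : slitDual L)
    (η : TangentSpace (slitModel E) (scale r ε) →L[ℝ] ℝ) :
    (cotangentIso E L).toFun ε (η.comp (dscale E L r ε)) =
      (r : ℝ) • (show Jet E L (proj E L ε) from (cotangentIso E L).toFun (scale r ε) η) := by
  -- Every covector is the differential of a homogenization, whose pull-back along `h_r` is known.
  obtain ⟨j, rfl⟩ := ((jetIso E L).toFun (scale r ε)).surjective η
  obtain ⟨s, rfl⟩ := (vanishing E L (proj E L ε)).mkQ_surjective j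
  have h1 : ((jetIso E L).toFun (scale r ε) (jet (proj E L ε) s) :
      TangentSpace (slitModel E) (scale r ε) →L[ℝ] ℝ).comp (dscale E L r ε) =
      (r : ℝ) • (show TangentSpace (slitModel E) ε →L[ℝ] ℝ from
        mfderiv (slitModel E) 𝓘(ℝ, ℝ) (homogenize s) ε) :=
    ContinuousLinearMap.ext fun v => mfderiv_homogenize_dscale r ε s v
  refine (congrArg ((cotangentIso E L).toFun ε) h1).trans ?_
  refine (((cotangentIso E L).toFun ε).map_smul (r : ℝ) _).trans ?_
  exact congrArg ((r : ℝ) • ·) ((cotangentIso_mfderiv ε s).trans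
    (cotangentIso_mfderiv (scale r ε) s).symm)

lemma atiyahEval_injective {l m : ℕ} {x : M} {T T' : (atiyah E L l m).V x}
    (h : ∀ Δ ψ, atiyahEval E L l m T Δ ψ = atiyahEval E L l m T' Δ ψ) : T = T' :=
  SmoothVB.eval_injective l fun Δ => SmoothVB.eval_injective m fun ψ => h Δ ψ

lemma atiyahEval_smul_right {l m : ℕ} {x : M} (T : (atiyah E L l m).V x)
    (Δ : Fin l → Der E L x) (c : ℝ) (ψ : Fin m → Jet E L x) :
    atiyahEval E L l m T Δ (fun j => c • ψ j) = c ^ m • atiyahEval E L l m T Δ ψ :=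
  SmoothVB.eval_smul_args (A := jetBundle E L) (C := lineVB E L) m c _ ψ

lemma tensorEval_smul {l m : ℕ} {ε : slitDual L} (c : ℝ) (T : (tensors E L l m).V ε)
    (v : Fin l → TangentSpace (slitModel E) ε)
    (θ : Fin m → (TangentSpace (slitModel E) ε →L[ℝ] ℝ)) :
    tensorEval E L l m (c • T) v θ = c * tensorEval E L l m T v θ :=
  (congrArg (fun S => SmoothVB.eval (SmoothVB.cotangent (slitModel E) (slitDual L))
    (SmoothVB.trivialLine _ _) m S θ) (SmoothVB.eval_smul l c T v)).trans
    (SmoothVB.eval_smul (A := SmoothVB.cotangent (slitModel E) (slitDual L))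
      (C := SmoothVB.trivialLine _ _) m c _ θ)

/-- A tensor is homogeneous if and only if the corresponding section of the pull-back bundle is
invariant under the action of the non-zero real numbers. -/
lemma isHomogeneous_iff {l m : ℕ} (𝒯 : (tensors E L l m).Sec) : IsHomogeneous 𝒯 ↔
    ∀ (r : ℝˣ) (ε : slitDual L),
      (show (atiyah E L l m).V (proj E L ε) from
        (tensorIso E L l m).toFun (scale r ε) (𝒯 (scale r ε))) =
      (tensorIso E L l m).toFun ε (𝒯 ε) := by
  refine forall_congr' fun r => forall_congr' fun ε => ?_
  -- The `m` covectors contribute `r ^ m`, which the weight `r ^ (1 - m)` turns into a single `r`.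
  have hl : ∀ (v : Fin l → TangentSpace (slitModel E) ε)
      (η : Fin m → (TangentSpace (slitModel E) (scale r ε) →L[ℝ] ℝ)),
      tensorEval E L l m (((r : ℝ) ^ (1 - (m : ℤ)) • 𝒯) ε) v
        (fun j => (η j).comp (dscale E L r ε)) =
      (r : ℝ) * ε.1.2 (atiyahEval E L l m (x := proj E L ε)
        ((tensorIso E L l m).toFun ε (𝒯 ε)) (fun i => (tangentIso E L).toFun ε (v i))
        (fun j => (cotangentIso E L).toFun (scale r ε) (η j))) := by
    intro v η
    refine (tensorEval_smul _ (𝒯 ε) v _).trans ?_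
    rw [← pairing_tensorIso]
    have h1 : (fun j => (cotangentIso E L).toFun ε ((η j).comp (dscale E L r ε))) =
        fun j => (r : ℝ) • (show Jet E L (proj E L ε) from
          (cotangentIso E L).toFun (scale r ε) (η j)) :=
      funext fun j => cotangentIso_comp_dscale r ε (η j)
    refine (congrArg (fun ψ => (r : ℝ) ^ (1 - (m : ℤ)) * (ε.1.2 (atiyahEval E L l m
      (x := proj E L ε) ((tensorIso E L l m).toFun ε (𝒯 ε))
      (fun i => (tangentIso E L).toFun ε (v i)) ψ) : ℝ))
      (h1 : @Eq (Fin m → Jet E L (proj E L ε)) _ _)).trans ?_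
    refine (congrArg (fun a : L (proj E L ε) => (r : ℝ) ^ (1 - (m : ℤ)) * (ε.1.2 a : ℝ))
      (atiyahEval_smul_right (x := proj E L ε) _ _ (r : ℝ) _)).trans ?_
    refine (congrArg ((r : ℝ) ^ (1 - (m : ℤ)) * ·) (ε.1.2.map_smul ((r : ℝ) ^ m) _)).trans ?_
    have h2 : (r : ℝ) ^ (1 - (m : ℤ)) * (r : ℝ) ^ m = r := by
      rw [← zpow_natCast, ← zpow_add₀ r.ne_zero, sub_add_cancel, zpow_one]
    exact (mul_assoc _ _ _).symm.trans (congrArg (· * _) h2)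
  -- Here the single factor `r` comes from pairing with `rε`.
  have hr : ∀ (v : Fin l → TangentSpace (slitModel E) ε)
      (η : Fin m → (TangentSpace (slitModel E) (scale r ε) →L[ℝ] ℝ)),
      tensorEval E L l m (𝒯 (scale r ε)) (fun i => dscale E L r ε (v i)) η =
      (r : ℝ) * ε.1.2 (atiyahEval E L l m (x := proj E L ε)
        ((tensorIso E L l m).toFun (scale r ε) (𝒯 (scale r ε)))
        (fun i => (tangentIso E L).toFun ε (v i))
        (fun j => (cotangentIso E L).toFun (scale r ε) (η j))) := by
    intro v η
    refine (pairing_tensorIso (scale r ε) (𝒯 (scale r ε)) _ η).symm.trans ?_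
    have h1 : (fun i => (tangentIso E L).toFun (scale r ε) (dscale E L r ε (v i))) =
        fun i => (tangentIso E L).toFun ε (v i) := funext fun i => tangentIso_dscale r ε (v i)
    exact congrArg (fun Δ => (r : ℝ) * (ε.1.2 (atiyahEval E L l m (x := proj E L ε)
        ((tensorIso E L l m).toFun (scale r ε) (𝒯 (scale r ε))) Δ
        (fun j => (cotangentIso E L).toFun (scale r ε) (η j))) : ℝ))
      (h1 : @Eq (Fin l → Der E L (proj E L ε)) _ _)
  -- The factor `r` cancels, and the isomorphisms are surjective, so all derivations and jets occur
  -- as arguments.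
  constructor
  · intro h
    refine atiyahEval_injective fun Δ ψ => ?_
    choose v hv using fun i => ((tangentIso E L).toFun ε).surjective (Δ i)
    choose η hη using fun j => ((cotangentIso E L).toFun (scale r ε)).surjective (ψ j)
    obtain rfl : (fun i => (tangentIso E L).toFun ε (v i)) = Δ := funext hv
    obtain rfl : (fun j => (cotangentIso E L).toFun (scale r ε) (η j)) = ψ := funext hη
    have h1 := ((hl v η).symm.trans (h v η)).trans (hr v η)
    exact ((pairing_bijective (E := E) ε).1 (mul_left_cancel₀ r.ne_zero h1)).symm
  · intro h v η
    refine (hl v η).trans (Eq.trans ?_ (hr v η).symm)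
    rw [← h]

/-- Points of `L* ∖ 0` over the same point of `M` differ by a non-zero factor. -/
lemma exists_scale_eq {ε η : slitDual L} (h : proj E L η = proj E L ε) :
    ∃ r : ℝˣ, scale r ε = η := by
  obtain ⟨⟨x, ξ⟩, hξ⟩ := ε
  obtain ⟨⟨y, ζ⟩, hζ⟩ := η
  obtain rfl : y = x := h
  -- With `ξ a = 1` every `b` is `ξ b • a`, hence `ζ = ζ a • ξ` and the factor is `ζ a`.
  obtain ⟨a, ha⟩ := (pairing_bijective (E := E) (⟨⟨y, ξ⟩, hξ⟩ : slitDual L)).2 1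
  have h1 : ζ = (ζ a : ℝ) • ξ := by
    ext b
    have h2 : b = (ξ b : ℝ) • a := by
      refine (pairing_bijective (E := E) (⟨⟨y, ξ⟩, hξ⟩ : slitDual L)).1 ?_
      refine Eq.trans ?_ (ξ.map_smul (ξ b : ℝ) a).symm
      exact ((congrArg ((ξ b : ℝ) * ·) ha).trans (mul_one _)).symm
    refine (congrArg ζ h2).trans ((ζ.map_smul _ _).trans ?_)
    exact mul_comm _ _
  have h0 : (ζ a : ℝ) ≠ 0 := fun h0 => hζ (by rw [h1, h0]; exact zero_smul ℝ ξ)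
  refine ⟨Units.mk0 _ h0, Subtype.ext ?_⟩
  exact congrArg (TotalSpace.mk (F := ℝ →L[ℝ] ℝ) (E := Dual L) y) h1.symm

variable (L) in
lemma exists_dual_ne_zero (x : M) : ∃ ξ : Dual L x, ξ ≠ 0 := by
  let e : L x ≃L[ℝ] ℝ := (trivializationAt ℝ L x).continuousLinearEquivAt ℝ x
    (FiberBundle.mem_baseSet_trivializationAt' x)
  refine ⟨(e : L x →L[ℝ] ℝ), fun h => one_ne_zero (α := ℝ) ?_⟩
  exact (e.apply_symm_apply 1).symm.trans (DFunLike.congr_fun h (e.symm 1))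

/-- Invariance and transitivity on the fibres of `p` make the value independent of the point chosen
above `x`. -/
lemma exists_atiyah_section {l m : ℕ} {𝒯 : (tensors E L l m).Sec} (h𝒯 : IsHomogeneous 𝒯) :
    ∃ T : (atiyah E L l m).Sec, ∀ ε, (tensorIso E L l m).toFun ε (𝒯 ε) = T (proj E L ε) := by
  choose ξ hξ using exists_dual_ne_zero L
  -- An arbitrary pointwise choice, with no continuity; smoothness is obtained below from local
  -- sections `σ`.
  let τ : M → slitDual L := fun x => ⟨⟨x, ξ x⟩, hξ x⟩
  let T : ∀ x, (atiyah E L l m).V x := fun x => (tensorIso E L l m).toFun (τ x) (𝒯 (τ x))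
  have hT : ∀ ε, (tensorIso E L l m).toFun ε (𝒯 ε) = T (proj E L ε) := fun ε => by
    obtain ⟨x, r, rfl⟩ : ∃ x r, scale r (τ x) = ε :=
      ⟨proj E L ε, exists_scale_eq (E := E) (ε := τ (proj E L ε)) rfl⟩
    exact (isHomogeneous_iff 𝒯).1 h𝒯 r (τ x)
  refine ⟨⟨T, fun x => ?_⟩, hT⟩
  obtain ⟨σ, hσx, hσ, hpσ⟩ := exists_localSection E (τ x)
  have h1 : (tensors E L l m).SmoothAt 𝓘(ℝ, E) (b := σ) (fun y => 𝒯 (σ y)) x :=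
    SmoothVB.smoothAt_section 𝒯 hσ
  have h2 := (SmoothVB.smoothAt_pullback_iff.1 ((tensorIso E L l m).smoothAt h1)).2
  have h3 : (fun y => (⟨y, T y⟩ : TotalSpace (atiyah E L l m).F (atiyah E L l m).V)) =ᶠ[𝓝 x]
      fun y => ⟨proj E L (σ y), (tensorIso E L l m).toFun (σ y) (𝒯 (σ y))⟩ := by
    filter_upwards [hpσ] with y hy
    rw [hT (σ y), hy]
  exact ContMDiffAt.congr_of_eventuallyEq h2 h3

lemma isHomogeneous_iff_exists {l m : ℕ} (𝒯 : (tensors E L l m).Sec) : IsHomogeneous 𝒯 ↔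
    ∃ T : (atiyah E L l m).Sec, ∀ ε, (tensorIso E L l m).toFun ε (𝒯 ε) = T (proj E L ε) := by
  refine ⟨exists_atiyah_section, ?_⟩
  rintro ⟨T, hT⟩
  refine (isHomogeneous_iff 𝒯).2 fun r ε => ?_
  exact (hT (scale r ε)).trans (hT ε).symm

variable (E L) in
/-- The homogeneous tensor corresponding to an Atiyah tensor. -/
def homogeneousTensor (l m : ℕ) : (atiyah E L l m).Sec →ₗ[ℝ] (tensors E L l m).Sec where
  toFun T := ⟨fun ε => ((tensorIso E L l m).toFun ε).symm (T (proj E L ε)), fun _ =>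
    (tensorIso E L l m).smoothAt_symm (b := fun ε => ε) (SmoothVB.smoothAt_pullback_iff.2
      ⟨contMDiffAt_id, SmoothVB.smoothAt_section T (proj E L).contMDiff.contMDiffAt⟩)⟩
  map_add' _ _ := ContMDiffSection.ext fun ε => ((tensorIso E L l m).toFun ε).symm.map_add _ _
  map_smul' _ _ := ContMDiffSection.ext fun ε => ((tensorIso E L l m).toFun ε).symm.map_smul _ _

lemma tensorIso_homogeneousTensor {l m : ℕ} (T : (atiyah E L l m).Sec) (ε : slitDual L) :
    (tensorIso E L l m).toFun ε (homogeneousTensor E L l m T ε) = T (proj E L ε) :=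
  ((tensorIso E L l m).toFun ε).apply_symm_apply (T (proj E L ε))

/-- Since `p` is surjective, a section is determined by its pull-back. -/
lemma homogeneousTensor_injective (l m : ℕ) :
    Function.Injective (homogeneousTensor E L l m) := by
  intro T T' h
  refine ContMDiffSection.ext fun x => ?_
  obtain ⟨ξ, hξ⟩ := exists_dual_ne_zero L x
  let ε : slitDual L := ⟨⟨x, ξ⟩, hξ⟩
  have h1 := (tensorIso_homogeneousTensor T ε).symm
  rw [h] at h1
  exact h1.trans (tensorIso_homogeneousTensor T' ε)

lemma range_homogeneousTensor (l m : ℕ) :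
    Set.range (homogeneousTensor E L l m) = {𝒯 | IsHomogeneous 𝒯} := by
  ext 𝒯
  refine Iff.trans ?_ (isHomogeneous_iff_exists 𝒯).symm
  constructor
  · rintro ⟨T, rfl⟩
    exact ⟨T, tensorIso_homogeneousTensor T⟩
  · rintro ⟨T, hT⟩
    refine ⟨T, ContMDiffSection.ext fun ε => ((tensorIso E L l m).toFun ε).injective ?_⟩
    exact (tensorIso_homogeneousTensor T ε).trans (hT ε).symm

end Homogeneous

end LineBundle

end

theorem mainTheorem8 {E : Type} [NormedAddCommGroup E] [NormedSpace ℝ E] [FiniteDimensional ℝ E]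
    {M : Type u} [TopologicalSpace M] [T2Space M] [ChartedSpace E M] [IsManifold 𝓘(ℝ, E) ∞ M]
    (L : M → Type u) [TopologicalSpace (TotalSpace ℝ L)] [∀ x, AddCommGroup (L x)]
    [∀ x, Module ℝ (L x)] [∀ x, TopologicalSpace (L x)] [FiberBundle ℝ L] [VectorBundle ℝ ℝ L]
    [ContMDiffVectorBundle ∞ ℝ L 𝓘(ℝ, E)] :
    ∃ (pT : (SmoothVB.tangent (slitModel E) (slitDual L)).Iso
          ((derBundle E L).pullback (proj E L)))
      (pT' : (SmoothVB.cotangent (slitModel E) (slitDual L)).Iso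
          ((jetBundle E L).pullback (proj E L))),
      (∀ (ε : slitDual L) (v : TangentSpace (slitModel E) ε) (s : Sec E L),
        ε.1.2 (derApply (x := proj E L ε) (pT.toFun ε v) s) =
          mfderiv (slitModel E) 𝓘(ℝ, ℝ) (homogenize s) ε v) ∧
      (∀ (ε : slitDual L) (s : Sec E L),
        pT'.toFun ε (mfderiv (slitModel E) 𝓘(ℝ, ℝ) (homogenize s) ε) = jet (proj E L ε) s) ∧
      ∀ l m : ℕ,
        ∃ Φ : (tensors E L l m).Iso ((atiyah E L l m).pullback (proj E L)),
          (∀ (ε : slitDual L) (T : (tensors E L l m).V ε)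
            (v : Fin l → TangentSpace (slitModel E) ε)
            (θ : Fin m → (TangentSpace (slitModel E) ε →L[ℝ] ℝ)),
            ε.1.2 (atiyahEval E L l m (x := proj E L ε) (Φ.toFun ε T)
                (fun i => pT.toFun ε (v i)) (fun j => pT'.toFun ε (θ j))) =
              tensorEval E L l m T v θ) ∧
          (∀ 𝒯 : (tensors E L l m).Sec, IsHomogeneous 𝒯 ↔
            ∃ T : (atiyah E L l m).Sec, ∀ ε, Φ.toFun ε (𝒯 ε) = T (proj E L ε)) ∧
          ∃ h : (atiyah E L l m).Sec →ₗ[ℝ] (tensors E L l m).Sec,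
            Function.Injective h ∧ Set.range h = {𝒯 | IsHomogeneous 𝒯} ∧
            ∀ (T : (atiyah E L l m).Sec) (ε : slitDual L),
              Φ.toFun ε (h T ε) = T (proj E L ε) := by
  refine ⟨tangentIso E L, cotangentIso E L, pairing_tangentIso, cotangentIso_mfderiv,
    fun l m => ⟨tensorIso E L l m, pairing_tensorIso, isHomogeneous_iff_exists,
      homogeneousTensor E L l m, homogeneousTensor_injective l m, range_homogeneousTensor l m,
      tensorIso_homogeneousTensor⟩⟩
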